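/- A \emph{scaled simplicial set} is a simplicial set with a set of 2-simplices (\emph{thin} triangles) containing all degenerate ones; maps preserve thin triangles. The \emph{scaled anodyne} maps are the smallest class of maps of scaled simplicial sets that is closed under cobase change, transfinite composition and retracts and contains (listing only non-degenerate thin triangles): (i) $(\Lambda^n_i,\{\Delta^{\{i-1,i,i+1\}}\})\to(\Delta^n,\{\Delta^{\{i-1,i,i+1\}}\})$ for $n\ge 2$, $0<i<n$ (on the left, the triangle is thin if it lies in the horn); (ii) $(\Delta^4,T)\to(\Delta^4,T\cup\{\Delta^{\{0,3,4\}},\Delta^{\{0,1,4\}}\})$ with $T=\{\Delta^{\{0,2,4\}},\Delta^{\{1,2,3\}},\Delta^{\{0,1,3\}},\Delta^{\{1,3,4\}},\Delta^{\{0,1,2\}}\}$; (iii) $(\Lambda^n_0\amalg_{\Delta^{\{0,1\}}}\Delta^0,\{\Delta^{\{0,1,n\}}\})\to(\Delta^n\amalg_{\Delta^{\{0,1\}}}\Delta^0,\{\Delta^{\{0,1,n\}}\})$ for $n\ge 3$. An \emph{$\infty$-bicategory} is a scaled simplicial set with the extension property with respect to scaled anodyne maps; a \emph{weak $\mathbf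 S$-fibration} is a map with the right lifting property with respect to scaled anodyne maps. For vertices $a,b$ of $X$, the mapping $\infty$-category $X(a,b)$ is the simplicial set whose $n$-simplices are the maps $\Delta^0\amalg_{\Delta^n}(\Delta^n\star\Delta^0)\to X$ sending the first vertex to $a$ and the second to $b$, i.e. the $(n+1)$-simplices of $X$ whose restriction to $\Delta^{\{0,\dots,n\}}$ is constant at $a$ and whose last vertex is $b$. A map $p:X\to S$ induces $p_{a,b}:X(a,b)\to S(p(a),p(b))$. A 2-simplex $\sigma$ of $X$ is \emph{left-degenerate} if $\sigma|_{\Delta^{\{0,1\}}}$ is degenerate; such a $\sigma$ with $\sigma(0)=a$ and $\sigma(2)=b$ is an edge of $X(a,b)$. \textbf{Proposition.} Let $X$ and $S$ be $\infty$-bicategories and let $p:X\to S$ be a weak $\mathbf S$-fibration. Let $\sigma:\Delta^2\to X$ be a left-degenerate triangle with $\sigma(0)=a$ and $\sigma(2)=b$. Then the following are equivalent: (1) $\sigma$ is $p$-coCartesian: for every $n\ge 3$, every commutative square of simplicial sets given by $f:\Lambda^n_0\to X$ and $g:\Delta^n\to S$ over $\Lambda^n_0\subset\Delta^n$ and $p$,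 with $f|_{\Delta^{\{0,1,n\}}}=\sigma$, admits a diagonal filler $\Delta^n\to X$; (2) $\sigma$ defines a $p_{a,b}$-coCartesian edge of $X(a,b)$: for every $n\ge 2$, every commutative square of simplicial sets given by $f:\Lambda^n_0\to X(a,b)$ and $g:\Delta^n\to S(p(a),p(b))$ over $\Lambda^n_0\subset\Delta^n$ and $p_{a,b}$, with $f|_{\Delta^{\{0,1\}}}$ equal to the edge defined by $\sigma$, admits a diagonal filler $\Delta^n\to X(a,b)$. -/

import Mathlib

open CategoryTheory Simplicial Opposite Limits

universe u

/-- A scaled simplicial set: a simplicial set together with a set of 2-simplices (the thin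
triangles) which contains all degenerate 2-simplices. -/
structure ScaledSSet : Type (u + 1) where
  /-- the underlying simplicial set -/
  toSSet : SSet.{u}
  /-- the thin triangles -/
  thin : Set (toSSet _⦋2⦌)
  degenerate_subset_thin : toSSet.degenerate 2 ⊆ thin

namespace ScaledSSet

/-- A map of scaled simplicial sets: a map of simplicial sets preserving thin triangles. -/
@[ext]
structure Hom (X Y : ScaledSSet.{u}) : Type u where
  /-- the underlying map of simplicial sets -/
  toHom : X.toSSet ⟶ Y.toSSet
  map_thin : ∀ t ∈ X.thin, toHom.app (op ⦋2⦌) t ∈ Y.thin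

instance : Category.{u} ScaledSSet.{u} where
  Hom := Hom
  id X := { toHom := 𝟙 X.toSSet, map_thin := fun _ ht => ht }
  comp f g :=
    { toHom := f.toHom ≫ g.toHom
      map_thin := fun t ht => g.map_thin _ (f.map_thin t ht) }

/-- The scaled simplicial set `(Y, T)`: the thin triangles are those in `T`, together with all
degenerate ones. -/
def ofTriangles (Y : SSet.{u}) (T : Set (Y _⦋2⦌)) : ScaledSSet.{u} where
  toSSet := Y
  thin := T ∪ Y.degenerate 2
  degenerate_subset_thin := Set.subset_union_right

/-- A map of simplicial sets carrying `T` into `U` is a map `(Y, T) ⟶ (Z, U)`. -/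
def ofTrianglesMap {Y Z : SSet.{u}} (f : Y ⟶ Z) (T : Set (Y _⦋2⦌)) (U : Set (Z _⦋2⦌))
    (h : ∀ t ∈ T, f.app (op ⦋2⦌) t ∈ U) : ofTriangles Y T ⟶ ofTriangles Z U :=
  { toHom := f
    map_thin := by
      rintro t (ht | ht)
      · exact Or.inl (h t ht)
      · exact Or.inr (SSet.degenerate_le_preimage f 2 ht) }

/-- The inclusion of a simplicial subset `A ⊆ Y`, whose thin triangles are the triangles of `A`
that lie in `T` (and the degenerate ones), into `(Y, T)`. -/
def subcomplexInclusion {Y : SSet.{u}} (A : Y.Subcomplex) (T : Set (Y _⦋2⦌)) :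
    ofTriangles (A : SSet.{u}) {t | A.ι.app (op ⦋2⦌) t ∈ T} ⟶ ofTriangles Y T :=
  ofTrianglesMap A.ι _ T fun _ ht => ht

/-- The simplicial set `Y ⨿_{Δ^1} Δ^0` obtained from `Y` by collapsing the edge `e` to a point. -/
noncomputable def collapse (Y : SSet.{u}) (e : Y _⦋1⦌) : SSet.{u} :=
  pushout (SSet.yonedaEquiv.symm e : Δ[1] ⟶ Y)
    (SSet.stdSimplex.map (SimplexCategory.σ 0) : (Δ[1] : SSet.{u}) ⟶ Δ[0])

/-- The quotient map `Y ⟶ Y ⨿_{Δ^1} Δ^0`. -/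
noncomputable def collapseMk (Y : SSet.{u}) (e : Y _⦋1⦌) : Y ⟶ collapse Y e :=
  pushout.inl _ _

/-- The map `Y ⨿_{Δ^1} Δ^0 ⟶ Z ⨿_{Δ^1} Δ^0` induced by a map `f : Y ⟶ Z` sending `e` to `e'`. -/
noncomputable def collapseMap {Y Z : SSet.{u}} (f : Y ⟶ Z) (e : Y _⦋1⦌) (e' : Z _⦋1⦌)
    (h : f.app (op ⦋1⦌) e = e') : collapse Y e ⟶ collapse Z e' :=
  pushout.map _ _ _ _ f (𝟙 _) (𝟙 _)
    (by rw [SSet.yonedaEquiv_symm_comp, h, Category.id_comp])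
    (by rw [Category.comp_id, Category.id_comp])

theorem collapseMk_map {Y Z : SSet.{u}} (f : Y ⟶ Z) (e : Y _⦋1⦌) (e' : Z _⦋1⦌)
    (h : f.app (op ⦋1⦌) e = e') :
    collapseMk Y e ≫ collapseMap f e e' h = f ≫ collapseMk Z e' :=
  pushout.inl_desc _ _ _

end ScaledSSet

namespace SSet

/-- The edge `Δ^{0,1}` of the horn `Λ^n_0` (here `n` is written as `n + 2`). -/
def hornEdge (n : ℕ) : (Λ[n + 2, 0] : SSet.{u}) _⦋1⦌ :=
  ⟨stdSimplex.edge (n + 2) 0 1 (Fin.zero_le _), by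
    rw [mem_horn_iff_notMem_range]
    refine ⟨Fin.last (n + 2), (Fin.last_pos).ne', ?_⟩
    rintro ⟨j, hj⟩
    fin_cases j
    · exact absurd (congrArg Fin.val hj) (by simp [stdSimplex.edge])
    · exact absurd (congrArg Fin.val hj) (by simp [stdSimplex.edge])⟩

/-- The triangle `Δ^{0,1,n}` of `Δ^n` (here `n` is written as `n + 3`). -/
def outerTriangle (n : ℕ) : (Δ[n + 3] : SSet.{u}) _⦋2⦌ :=
  stdSimplex.triangle 0 1 (Fin.last (n + 3)) (Fin.zero_le _) (Fin.le_last _)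

/-- The triangle `Δ^{0,1,n}` of the horn `Λ^n_0` (here `n` is written as `n + 3`). -/
def hornTriangle (n : ℕ) : (Λ[n + 3, 0] : SSet.{u}) _⦋2⦌ :=
  ⟨outerTriangle n, by
    rw [mem_horn_iff_notMem_range]
    refine ⟨⟨2, by lia⟩, ?_, ?_⟩
    · exact fun h => absurd (congrArg Fin.val h) (by simp)
    rintro ⟨j, hj⟩
    fin_cases j
    · exact absurd (congrArg Fin.val hj) (by simp [outerTriangle, stdSimplex.triangle])
    · exact absurd (congrArg Fin.val hj) (by simp [outerTriangle, stdSimplex.triangle])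
    · exact absurd (congrArg Fin.val hj) (by simp [outerTriangle, stdSimplex.triangle])⟩

end SSet

namespace ScaledSSet

/-- The triangles `{0,2,4}, {1,2,3}, {0,1,3}, {1,3,4}, {0,1,2}` of `Δ^4`. -/
def saturationSource : Set ((Δ[4] : SSet.{u}) _⦋2⦌) :=
  {SSet.stdSimplex.triangle 0 2 4 (by decide) (by decide),
    SSet.stdSimplex.triangle 1 2 3 (by decide) (by decide),
    SSet.stdSimplex.triangle 0 1 3 (by decide) (by decide),
    SSet.stdSimplex.triangle 1 3 4 (by decide) (by decide),
    SSet.stdSimplex.triangle 0 1 2 (by decide) (by decide)}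

/-- The triangles of `saturationSource` together with `{0,3,4}` and `{0,1,4}`. -/
def saturationTarget : Set ((Δ[4] : SSet.{u}) _⦋2⦌) :=
  saturationSource ∪
    {SSet.stdSimplex.triangle 0 3 4 (by decide) (by decide),
      SSet.stdSimplex.triangle 0 1 4 (by decide) (by decide)}

/-- The map `Λ^n_0 ⨿_{Δ^{0,1}} Δ^0 ⟶ Δ^n ⨿_{Δ^{0,1}} Δ^0`, where in both sides the image of
`Δ^{0,1,n}` is thin (here `n` is written as `n + 3`). -/
noncomputable def outerHornMap (n : ℕ) :
    ofTriangles (collapse (Λ[n + 3, 0] : SSet.{u}) (SSet.hornEdge (n + 1)))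
        {(collapseMk _ _).app (op ⦋2⦌) (SSet.hornTriangle n)} ⟶
      ofTriangles (collapse (Δ[n + 3] : SSet.{u})
          (SSet.stdSimplex.edge (n + 3) 0 1 (Fin.zero_le _)))
        {(collapseMk _ _).app (op ⦋2⦌) (SSet.outerTriangle n)} :=
  ofTrianglesMap (collapseMap (Λ[n + 3, 0] : (Δ[n + 3] : SSet.{u}).Subcomplex).ι _ _ rfl) _ _ (by
    rintro t rfl
    exact congrArg (fun g => g.app (op ⦋2⦌) (SSet.hornTriangle n))
      (collapseMk_map (Λ[n + 3, 0] : (Δ[n + 3] : SSet.{u}).Subcomplex).ι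
        (SSet.hornEdge (n + 1)) _ rfl))

/-- The generating scaled anodyne maps. -/
inductive generatingScaledAnodyne : MorphismProperty ScaledSSet.{u}
  /-- `(Λ^m_k, {Δ^{k-1,k,k+1}}) ⟶ (Δ^m, {Δ^{k-1,k,k+1}})` for `m ≥ 2` and `0 < k < m`, with
  `m = n + 2` and `k = i + 1`. -/
  | inner (n : ℕ) (i : Fin (n + 1)) :
      generatingScaledAnodyne
        (subcomplexInclusion (Λ[n + 2, i.castSucc.succ] : (Δ[n + 2] : SSet.{u}).Subcomplex)
          {SSet.stdSimplex.triangle i.castSucc.castSucc i.castSucc.succ i.succ.succ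
            (Fin.castSucc_le_succ _) (Fin.succ_le_succ_iff.2 (Fin.castSucc_le_succ _))})
  /-- the saturation map on `Δ^4` -/
  | saturation :
      generatingScaledAnodyne
        (ofTrianglesMap (𝟙 (Δ[4] : SSet.{u})) saturationSource saturationTarget
          fun _ ht => Or.inl ht)
  /-- the outer horns with collapsed edge `Δ^{0,1}`, in dimension `n + 3` -/
  | outer (n : ℕ) : generatingScaledAnodyne (outerHornMap n)

/-- A class of maps is weakly saturated if it is closed under cobase change, transfinite
composition and retracts. -/
structure IsWeaklySaturated (W : MorphismProperty ScaledSSet.{u}) : Prop where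
  cobaseChange : W.IsStableUnderCobaseChange
  transfiniteComposition : MorphismProperty.IsStableUnderTransfiniteComposition.{u} W
  retracts : W.IsStableUnderRetracts

/-- The scaled anodyne maps: the smallest weakly saturated class of maps containing the
generating scaled anodyne maps. -/
def scaledAnodyne : MorphismProperty ScaledSSet.{u} :=
  sInf {W | IsWeaklySaturated W ∧ generatingScaledAnodyne ≤ W}

/-- A weak **S**-fibration: a map with the right lifting property with respect to all scaled
anodyne maps. -/
def IsWeakSFibration {X S : ScaledSSet.{u}} (p : X ⟶ S) : Prop :=
  scaledAnodyne.rlp p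

/-- An ∞-bicategory: a scaled simplicial set with the extension property with respect to all
scaled anodyne maps. -/
def IsInfinityBicategory (X : ScaledSSet.{u}) : Prop :=
  ∀ ⦃A B : ScaledSSet.{u}⦄ (i : A ⟶ B), scaledAnodyne i → ∀ f : A ⟶ X, ∃ g : B ⟶ X, i ≫ g = f

end ScaledSSet

namespace SSet

/-- The map `θ ⋆ [0] : [m] ⋆ [0] ⟶ [n] ⋆ [0]`, that is, the monotone map `[m + 1] ⟶ [n + 1]` which
agrees with `θ` on `[m]` and preserves the last elements. -/
def joinPointHom {m n : SimplexCategory} (θ : m ⟶ n) :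
    Fin (m.len + 1 + 1) →o Fin (n.len + 1 + 1) where
  toFun := Fin.lastCases (motive := fun _ => Fin (n.len + 1 + 1)) (Fin.last (n.len + 1))
    fun j => (θ.toOrderHom j).castSucc
  monotone' := by
    intro i j hij
    induction j using Fin.lastCases with
    | last => simpa using Fin.le_last _
    | cast j =>
      induction i using Fin.lastCases with
      | last => exact absurd hij (not_le.2 (Fin.castSucc_lt_last j))
      | cast i =>
        simpa using θ.toOrderHom.monotone (Fin.castSucc_le_castSucc_iff.1 hij)

theorem joinPointHom_last {m n : SimplexCategory} (θ : m ⟶ n) :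
    joinPointHom θ (Fin.last (m.len + 1)) = Fin.last (n.len + 1) :=
  Fin.lastCases_last (motive := fun _ => Fin (n.len + 1 + 1))

theorem joinPointHom_castSucc {m n : SimplexCategory} (θ : m ⟶ n) (j : Fin (m.len + 1)) :
    joinPointHom θ j.castSucc = (θ.toOrderHom j).castSucc :=
  Fin.lastCases_castSucc (motive := fun _ => Fin (n.len + 1 + 1)) j

/-- The functor `[n] ↦ [n] ⋆ [0] = [n + 1]`, so that `Δ^n ⋆ Δ^0 = Δ^{n+1}`. -/
def joinPoint : SimplexCategory ⥤ SimplexCategory where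
  obj n := ⦋n.len + 1⦌
  map θ := SimplexCategory.Hom.mk (joinPointHom θ)
  map_id n := by
    ext i : 3
    change joinPointHom (𝟙 n) i = i
    induction i using Fin.lastCases with
    | last => exact joinPointHom_last _
    | cast i => exact joinPointHom_castSucc _ i
  map_comp f g := by
    ext i : 3
    change joinPointHom (f ≫ g) i = joinPointHom g (joinPointHom f i)
    induction i using Fin.lastCases with
    | last => rw [joinPointHom_last, joinPointHom_last, joinPointHom_last]
    | cast i =>
      exact (joinPointHom_castSucc _ i).trans
        (((congrArg _ (joinPointHom_castSucc f i)).trans (joinPointHom_castSucc g _)).symm)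

/-- The inclusion `[n] ⟶ [n] ⋆ [0]`. -/
def joinPointInl : 𝟭 SimplexCategory ⟶ joinPoint where
  app n := SimplexCategory.Hom.mk (Fin.castSuccOrderEmb (n := n.len + 1)).toOrderHom
  naturality m n θ := by
    ext i : 3
    exact (joinPointHom_castSucc θ i).symm

/-- The inclusion `[0] ⟶ [n] ⋆ [0]` of the join point. -/
def joinPointInr (n : SimplexCategory) : ⦋0⦌ ⟶ joinPoint.obj n :=
  SimplexCategory.const ⦋0⦌ (joinPoint.obj n) (Fin.last (n.len + 1))

theorem joinPointInr_comp {m n : SimplexCategory} (θ : m ⟶ n) :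
    joinPointInr m ≫ joinPoint.map θ = joinPointInr n := by
  ext i : 3
  exact joinPointHom_last θ

theorem map_op_map_op (X : SSet.{u}) {l m n : SimplexCategory} (f : l ⟶ m) (g : m ⟶ n)
    (x : X.obj (op n)) : X.map f.op (X.map g.op x) = X.map (f ≫ g).op x := by
  simp

theorem map_op_app {X Y : SSet.{u}} (p : X ⟶ Y) {m n : SimplexCategory} (f : m ⟶ n)
    (x : X.obj (op n)) : Y.map f.op (p.app (op n) x) = p.app (op m) (X.map f.op x) :=
  (NatTrans.naturality_apply p f.op x).symm

/-- The simplicial set with `n`-simplices the maps `Δ^n ⋆ Δ^0 ⟶ X`. -/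
def cones (X : SSet.{u}) : SSet.{u} := joinPoint.op ⋙ X

/-- The map of simplicial sets `cones X ⟶ cones Y` given by postcomposition with `f`. -/
def conesMap {X Y : SSet.{u}} (f : X ⟶ Y) : cones X ⟶ cones Y :=
  Functor.whiskerLeft joinPoint.op f

/-- The constant `n`-simplex on a vertex `a`. -/
def constSimplex (X : SSet.{u}) (n : SimplexCategoryᵒᵖ) (a : X _⦋0⦌) : X.obj n :=
  X.map (SimplexCategory.const n.unop ⦋0⦌ 0).op a

/-- The mapping space `X(a, b)`. An `n`-simplex is a map `Δ^0 ⨿_{Δ^n} (Δ^n ⋆ Δ^0) ⟶ X` sending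
the first vertex to `a` and the second to `b`, that is, a map `Δ^n ⋆ Δ^0 ⟶ X` which is
constant at `a` on `Δ^n` and takes the value `b` at the join point. -/
def mappingSpace (X : SSet.{u}) (a b : X _⦋0⦌) : (cones X).Subcomplex where
  obj n := {x |
    X.map (joinPointInl.app n.unop).op x = constSimplex X n a ∧
      X.map (joinPointInr n.unop).op x = b}
  map {m n} θ := by
    rintro x ⟨h₁, h₂⟩
    refine ⟨?_, ?_⟩
    · refine (map_op_map_op X _ _ _).trans ?_
      rw [← joinPointInl.naturality]
      refine (map_op_map_op X θ.unop _ _).symm.trans ?_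
      refine (congrArg (X.map θ.unop.op) h₁).trans ?_
      exact map_op_map_op X _ _ a
    · refine (map_op_map_op X _ _ _).trans ?_
      rw [joinPointInr_comp]
      exact h₂

/-- The map `X(a, b) ⟶ S(p a, p b)` induced by `p : X ⟶ S`. -/
def mappingSpaceMap {X S : SSet.{u}} (p : X ⟶ S) (a b : X _⦋0⦌) :
    (mappingSpace X a b : SSet.{u}) ⟶
      (mappingSpace S (p.app (op ⦋0⦌) a) (p.app (op ⦋0⦌) b) : SSet.{u}) :=
  Subfunctor.lift ((mappingSpace X a b).ι ≫ conesMap p) (by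
    rintro n _ ⟨⟨x, h₁, h₂⟩, rfl⟩
    refine ⟨?_, ?_⟩
    · refine (map_op_app p _ _).trans ((congrArg (p.app _) h₁).trans ?_)
      exact (map_op_app p _ a).symm
    · exact (map_op_app p _ _).trans (congrArg (p.app _) h₂))

/-- The edge `e` of `Y` is `q`-coCartesian: every lifting problem for `Λ^n_0 ⟶ Δ^n` against `q`,
`n ≥ 2`, such that the horn restricts to `e` on `Δ^{0,1}`, has a solution. -/
def IsCoCartesianEdge {Y Z : SSet.{u}} (q : Y ⟶ Z) (e : Y _⦋1⦌) : Prop :=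
  ∀ (n : ℕ) (f : (Λ[n + 2, 0] : SSet.{u}) ⟶ Y) (g : Δ[n + 2] ⟶ Z),
    f ≫ q = Λ[n + 2, 0].ι ≫ g → f.app (op ⦋1⦌) (hornEdge n) = e →
      ∃ l : Δ[n + 2] ⟶ Y, Λ[n + 2, 0].ι ≫ l = f ∧ l ≫ q = g

/-- A 2-simplex is left-degenerate if its restriction to `Δ^{0,1}` is degenerate. -/
def IsLeftDegenerate {X : SSet.{u}} (σ : X _⦋2⦌) : Prop :=
  X.δ 2 σ ∈ X.degenerate 1

/-- The `i`-th vertex of a 2-simplex. -/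
def triangleVertex {X : SSet.{u}} (σ : X _⦋2⦌) (i : Fin 3) : X _⦋0⦌ :=
  X.map (SimplexCategory.const ⦋0⦌ ⦋2⦌ i).op σ

/-- The 2-simplex `σ` of `X` is `p`-coCartesian (this is used for left-degenerate `σ`): every
lifting problem for `Λ^n_0 ⟶ Δ^n` against `p`, `n ≥ 3`, such that the horn restricts to `σ` on
`Δ^{0,1,n}`, has a solution. -/
def IsCoCartesianTriangle {X S : SSet.{u}} (p : X ⟶ S) (σ : X _⦋2⦌) : Prop :=
  ∀ (n : ℕ) (f : (Λ[n + 3, 0] : SSet.{u}) ⟶ X) (g : Δ[n + 3] ⟶ S),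
    f ≫ p = Λ[n + 3, 0].ι ≫ g → f.app (op ⦋2⦌) (hornTriangle n) = σ →
      ∃ l : Δ[n + 3] ⟶ X, Λ[n + 3, 0].ι ≫ l = f ∧ l ≫ p = g

/-- The edge of `X(a, b)` defined by a left-degenerate 2-simplex `σ` with `σ(0) = a` and
`σ(2) = b`. -/
def mappingSpaceEdge {X : SSet.{u}} (σ : X _⦋2⦌) (hσ : IsLeftDegenerate σ) {a b : X _⦋0⦌}
    (ha : triangleVertex σ 0 = a) (hb : triangleVertex σ 2 = b) :
    (mappingSpace X a b : SSet.{u}) _⦋1⦌ :=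
  ⟨σ, by
    subst ha hb
    refine ⟨?_, rfl⟩
    have hδ : (joinPointInl.app ⦋1⦌ : ⦋1⦌ ⟶ ⦋2⦌) = SimplexCategory.δ 2 := by
      ext i : 3
      fin_cases i <;> rfl
    obtain ⟨y, hy⟩ : ∃ y : X _⦋0⦌, X.σ 0 y = X.δ 2 σ := by
      have h := hσ
      rw [IsLeftDegenerate, degenerate_eq_iUnion_range_σ] at h
      simpa using h
    have h0 : triangleVertex σ 0 = y := by
      have h1 : triangleVertex σ 0 = X.map (SimplexCategory.δ 1).op (X.δ 2 σ) := by
        refine Eq.trans ?_ (map_op_map_op X (SimplexCategory.δ 1) (SimplexCategory.δ 2) σ).symm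
        have h2 : SimplexCategory.const ⦋0⦌ ⦋2⦌ 0 =
            SimplexCategory.δ (1 : Fin 2) ≫ SimplexCategory.δ (2 : Fin 3) := by
          ext i : 3
          fin_cases i
          rfl
        rw [triangleVertex, h2]
      rw [h1, ← hy]
      refine (map_op_map_op X _ (SimplexCategory.σ 0) y).trans ?_
      have h2 : SimplexCategory.δ 1 ≫ SimplexCategory.σ (0 : Fin 1) = 𝟙 _ :=
        SimplexCategory.δ_comp_σ_succ
      rw [h2]
      simp
    have h3 : SimplexCategory.σ (0 : Fin 1) = SimplexCategory.const ⦋1⦌ ⦋0⦌ 0 := by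
      ext i : 3
      exact Subsingleton.elim (α := Fin 1) _ _
    change X.map (joinPointInl.app ⦋1⦌).op σ = _
    rw [hδ, h0]
    refine Eq.trans hy.symm ?_
    change X.map (SimplexCategory.σ 0).op y = X.map (SimplexCategory.const ⦋1⦌ ⦋0⦌ 0).op y
    rw [h3]⟩

end SSet

/-! An `m`-simplex of `X(a, b)` is an `(m+1)`-simplex of `X` whose last face is constant at `a` and
whose last vertex is `b`. Hence a horn `Λ^{n+2}_0` in `X(a, b)` amounts to a horn `Λ^{n+3}_0` in `X`
with constant last face: the face opposite `j` in the first becomes the face opposite `j` in the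
second. This correspondence gives (1) ⇒ (2) (`exists_horn_of_mappingSpace`,
`isCoCartesianEdge_of_triangle`), and it gives (2) ⇒ (1) for horns whose last face is constant
(`hornFills_const`).

For (2) ⇒ (1) in general, let `h` be the last face of a horn `Λ^{n+3}_0` that restricts to `σ`. The
edge `{0,1}` of `h` is the constant edge at `a`, because `σ` is left-degenerate. So `β^* h` is
constant when `β` fixes `0` and sends every other vertex to `1`. One passes from `h` to `β^* h`
through pullbacks `α^* h`, lowering one vertex at a time to its predecessor (`hornFills_map`).

A single move (`hornFills_of_duplicate`) takes place in a simplex of one dimension more, where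
vertex `i` is doubled. Let `k = i + 1` be the new copy and `k' = i + 2` the old vertex `i + 1`. The
given horn lies in the face opposite `k`, and the horn with the modified last face lies in the face
opposite `k'`. The last face is `h` with `i` doubled. Its triangles that begin with `k, k'` are
degenerate, which lets `exists_fillPair` extend the data by filling inner horns at `k'`, first in
`S` and then in `X` over `S`. Once the horn opposite `k'` is filled, inner horns at `k` (with
degenerate thin triangle `{i, k, k'}`) fill the face opposite `0` and then the whole simplex. The
face opposite `k` of the result solves the original problem.

The only generators that enter are the inner ones; the last vertex is never an interior vertex of
the horns being filled, and the thin triangles are tracked explicitly. -/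

namespace SSet

/-! ### Partial maps on a simplex, indexed by vertex sets. -/

/-- The set of vertices of a simplex of `Δ^N`. -/
def vset {N : ℕ} {m : SimplexCategory} (θ : m ⟶ ⦋N⦌) : Finset (Fin (N + 1)) :=
  Finset.univ.image θ.toOrderHom

theorem mem_vset {N : ℕ} {m : SimplexCategory} (θ : m ⟶ ⦋N⦌) (j : Fin (N + 1)) :
    j ∈ vset θ ↔ ∃ i, θ.toOrderHom i = j := by
  simp [vset]

theorem vset_comp_subset {N : ℕ} {l m : SimplexCategory} (γ : l ⟶ m) (θ : m ⟶ ⦋N⦌) :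
    vset (γ ≫ θ) ⊆ vset θ := by
  intro j hj
  obtain ⟨i, rfl⟩ := (mem_vset _ _).1 hj
  exact (mem_vset _ _).2 ⟨γ.toOrderHom i, rfl⟩

theorem mem_vset_comp {M N : ℕ} {l : SimplexCategory} (γ : l ⟶ ⦋M⦌) (e : ⦋M⦌ ⟶ ⦋N⦌)
    (j : Fin (N + 1)) :
    j ∈ vset (γ ≫ e) ↔ ∃ i ∈ vset γ, e.toOrderHom i = j := by
  simp only [mem_vset]
  constructor
  · rintro ⟨i, rfl⟩
    exact ⟨_, ⟨i, rfl⟩, rfl⟩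
  · rintro ⟨_, ⟨i, rfl⟩, rfl⟩
    exact ⟨i, rfl⟩

theorem eq_of_comp_mono {M N : ℕ} {e : ⦋M⦌ ⟶ ⦋N⦌} (he : Function.Injective e.toOrderHom)
    {m : SimplexCategory} {γ γ' : m ⟶ ⦋M⦌} (h : γ ≫ e = γ' ≫ e) : γ = γ' := by
  ext i : 3
  exact he (congrArg (fun θ : m ⟶ ⦋N⦌ => θ.toOrderHom i) h)

theorem exists_factor {M N : ℕ} {e : ⦋M⦌ ⟶ ⦋N⦌} (he : Function.Injective e.toOrderHom)
    {m : SimplexCategory} (θ : m ⟶ ⦋N⦌) (h : vset θ ⊆ vset e) : ∃ γ : m ⟶ ⦋M⦌, γ ≫ e = θ := by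
  have hs : ∀ i, ∃ j, e.toOrderHom j = θ.toOrderHom i := fun i =>
    (mem_vset _ _).1 (h ((mem_vset _ _).2 ⟨i, rfl⟩))
  choose c hc using hs
  have hmono : StrictMono e.toOrderHom := e.toOrderHom.monotone.strictMono_of_injective he
  refine ⟨SimplexCategory.Hom.mk ⟨c, fun i j hij => ?_⟩, ?_⟩
  · rw [← hmono.le_iff_le, hc, hc]
    exact θ.toOrderHom.monotone hij
  · ext i : 3
    exact hc i

/-- A map to `X` defined on the simplices of `Δ^N` whose set of vertices belongs to `F`. -/
structure PartialMap (N : ℕ) (F : Set (Finset (Fin (N + 1)))) (X : SSet.{u}) where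
  /-- the value on a simplex -/
  val : ∀ {m : SimplexCategory} (θ : m ⟶ ⦋N⦌), vset θ ∈ F → X.obj (op m)
  naturality : ∀ {l m : SimplexCategory} (γ : l ⟶ m) (θ : m ⟶ ⦋N⦌) (h : vset θ ∈ F)
    (h' : vset (γ ≫ θ) ∈ F), X.map γ.op (val θ h) = val (γ ≫ θ) h'

namespace PartialMap

variable {N : ℕ} {F : Set (Finset (Fin (N + 1)))} {X S : SSet.{u}}

theorem val_congr (φ : PartialMap N F X) {m : SimplexCategory} {θ θ' : m ⟶ ⦋N⦌} (h : θ = θ')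
    (hθ : vset θ ∈ F) : φ.val θ hθ = φ.val θ' (h ▸ hθ) := by
  subst h; rfl

/-- The partial map `φ` lies over the simplex `y`. -/
def Over (φ : PartialMap N F X) (p : X ⟶ S) (y : S.obj (op ⦋N⦌)) : Prop :=
  ∀ ⦃m : SimplexCategory⦄ (θ : m ⟶ ⦋N⦌) (h : vset θ ∈ F),
    p.app (op m) (φ.val θ h) = S.map θ.op y

/-- The partial map `ψ` extends `φ`. -/
def Extends {G : Set (Finset (Fin (N + 1)))} (ψ : PartialMap N G X) (φ : PartialMap N F X) :
    Prop :=
  ∀ ⦃m : SimplexCategory⦄ (θ : m ⟶ ⦋N⦌) (h : vset θ ∈ F), ∃ h' : vset θ ∈ G,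
    ψ.val θ h' = φ.val θ h

theorem Extends.trans {G H : Set (Finset (Fin (N + 1)))} {χ : PartialMap N H X}
    {ψ : PartialMap N G X} {φ : PartialMap N F X} (h₁ : χ.Extends ψ) (h₂ : ψ.Extends φ) :
    χ.Extends φ := by
  intro m θ h
  obtain ⟨h', e⟩ := h₂ θ h
  obtain ⟨h'', e'⟩ := h₁ θ h'
  exact ⟨h'', e'.trans e⟩

theorem Extends.val_eq {G : Set (Finset (Fin (N + 1)))} {ψ : PartialMap N G X}
    {φ : PartialMap N F X} (h : ψ.Extends φ) {m : SimplexCategory} (θ : m ⟶ ⦋N⦌)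
    (hG : vset θ ∈ G) (hF : vset θ ∈ F) : ψ.val θ hG = φ.val θ hF := (h θ hF).2

/-- Restriction of a partial map. -/
def restrict (φ : PartialMap N F X) (G : Set (Finset (Fin (N + 1)))) (h : G ⊆ F) :
    PartialMap N G X where
  val θ hθ := φ.val θ (h hθ)
  naturality γ θ _ _ := φ.naturality γ θ _ _

/-- The partial map given by a simplex of `X`. -/
def ofSimplex (x : X.obj (op ⦋N⦌)) (F : Set (Finset (Fin (N + 1)))) : PartialMap N F X where
  val θ _ := X.map θ.op x
  naturality γ θ _ _ := map_op_map_op X γ θ x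

/-- Restriction of a partial map along `e : Δ^M ⟶ Δ^N`. -/
def comp {M : ℕ} (φ : PartialMap N F X) (e : ⦋M⦌ ⟶ ⦋N⦌) (G : Set (Finset (Fin (M + 1))))
    (h : ∀ ⦃m : SimplexCategory⦄ (θ : m ⟶ ⦋M⦌), vset θ ∈ G → vset (θ ≫ e) ∈ F) :
    PartialMap M G X where
  val θ hθ := φ.val (θ ≫ e) (h θ hθ)
  naturality γ θ _ _ := by
    rw [φ.naturality γ (θ ≫ e) _ (by rw [← Category.assoc]; exact h _ ‹_›)]
    exact φ.val_congr (Category.assoc _ _ _).symm _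

/-- The simplex of `X` given by a partial map defined on all of `Δ^N`. -/
theorem exists_simplex (φ : PartialMap N F X) (h : vset (𝟙 ⦋N⦌) ∈ F) {m : SimplexCategory}
    (θ : m ⟶ ⦋N⦌) (hθ : vset θ ∈ F) : φ.val θ hθ = X.map θ.op (φ.val (𝟙 _) h) := by
  rw [φ.naturality θ (𝟙 _) h (by rwa [Category.comp_id])]
  exact φ.val_congr (Category.comp_id _).symm _

/-- Transport of a partial map along an injective map `e : Δ^M ⟶ Δ^N`. -/
theorem exists_push {M : ℕ} {G : Set (Finset (Fin (M + 1)))} (φ : PartialMap M G X)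
    (e : ⦋M⦌ ⟶ ⦋N⦌) (he : Function.Injective e.toOrderHom) (hsub : ∀ s ∈ F, s ⊆ vset e)
    (hF : ∀ ⦃m : SimplexCategory⦄ (γ : m ⟶ ⦋M⦌), vset (γ ≫ e) ∈ F → vset γ ∈ G) :
    ∃ ψ : PartialMap N F X, ∀ ⦃m : SimplexCategory⦄ (γ : m ⟶ ⦋M⦌) (h : vset (γ ≫ e) ∈ F),
      ψ.val (γ ≫ e) h = φ.val γ (hF γ h) := by
  choose c hc using fun (m : SimplexCategory) (θ : m ⟶ ⦋N⦌) (h : vset θ ∈ F) =>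
    exists_factor he θ (hsub _ h)
  have key : ∀ (m : SimplexCategory) (γ : m ⟶ ⦋M⦌) (h : vset (γ ≫ e) ∈ F),
      c m (γ ≫ e) h = γ := fun m γ h => eq_of_comp_mono he (hc _ _ _)
  refine ⟨⟨fun {m} θ h => φ.val (c m θ h) (hF _ (by rwa [hc])), ?_⟩, ?_⟩
  · intro l m γ θ h h'
    have : γ ≫ c m θ h = c l (γ ≫ θ) h' := eq_of_comp_mono he (by
      rw [Category.assoc, hc, hc])
    rw [φ.naturality γ _ _ (by rw [this]; exact hF _ (by rwa [hc]))]
    exact φ.val_congr this _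
  · intro m γ h
    exact φ.val_congr (key m γ h) _

/-- Extension of a partial map along a simplex. -/
theorem exists_extend {M : ℕ} (hF : IsLowerSet F) (φ : PartialMap N F X) (e : ⦋M⦌ ⟶ ⦋N⦌)
    (he : Function.Injective e.toOrderHom) (x : X.obj (op ⦋M⦌))
    (hx : ∀ ⦃m : SimplexCategory⦄ (γ : m ⟶ ⦋M⦌) (h : vset (γ ≫ e) ∈ F),
      φ.val (γ ≫ e) h = X.map γ.op x)
    (G : Set (Finset (Fin (N + 1)))) (hFG : F ⊆ G)
    (hG : ∀ s ∈ G, s ∉ F → s ⊆ vset e) :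
    ∃ ψ : PartialMap N G X, ψ.Extends φ ∧
      ∀ ⦃m : SimplexCategory⦄ (γ : m ⟶ ⦋M⦌) (h : vset (γ ≫ e) ∈ G),
        ψ.val (γ ≫ e) h = X.map γ.op x := by
  classical
  -- A simplex outside `F` factors through `e`, uniquely since `e` is injective; uniqueness is what
  -- makes the chosen values natural.
  choose c hc using fun (m : SimplexCategory) (θ : m ⟶ ⦋N⦌) (h : vset θ ∈ G) (h' : vset θ ∉ F) =>
    exists_factor he θ (hG _ h h')
  refine ⟨⟨fun {m} θ h => if h' : vset θ ∈ F then φ.val θ h' else X.map (c m θ h h').op x, ?_⟩,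
    ?_, ?_⟩
  · intro l m γ θ h h'
    by_cases h₁ : vset θ ∈ F
    · have h₂ : vset (γ ≫ θ) ∈ F := hF (vset_comp_subset γ θ) h₁
      rw [dif_pos h₁, dif_pos h₂, φ.naturality γ θ h₁ h₂]
    · rw [dif_neg h₁, map_op_map_op]
      by_cases h₂ : vset (γ ≫ θ) ∈ F
      · have h₃ : γ ≫ θ = (γ ≫ c m θ h h₁) ≫ e := by rw [Category.assoc, hc]
        rw [dif_pos h₂, φ.val_congr h₃, hx]
      · rw [dif_neg h₂]
        have h₃ : γ ≫ c m θ h h₁ = c l (γ ≫ θ) h' h₂ := eq_of_comp_mono he (by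
          rw [Category.assoc, hc, hc])
        rw [h₃]
  · intro m θ h
    exact ⟨hFG h, dif_pos h⟩
  · intro m γ h
    by_cases h₁ : vset (γ ≫ e) ∈ F
    · exact (dif_pos h₁).trans (hx γ h₁)
    · refine (dif_neg h₁).trans ?_
      rw [eq_of_comp_mono he (hc _ (γ ≫ e) h h₁)]

end PartialMap

end SSet

/-! ### Lifting against inner scaled horns, for `p` and for `S`. -/

namespace ScaledSSet

open SSet

/-- The right lifting property with respect to the inner generating scaled anodyne maps. -/
def HasInnerLifts {X S : ScaledSSet.{u}} (p : X ⟶ S) : Prop :=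
  ∀ (n : ℕ) (i : Fin (n + 1)) (f : (Λ[n + 2, i.castSucc.succ] : SSet.{u}) ⟶ X.toSSet)
    (g : Δ[n + 2] ⟶ S.toSSet), f ≫ p.toHom = Λ[n + 2, i.castSucc.succ].ι ≫ g →
    (∀ t : (Λ[n + 2, i.castSucc.succ] : SSet.{u}) _⦋2⦌,
      t.1 0 = i.castSucc.castSucc → t.1 1 = i.castSucc.succ → t.1 2 = i.succ.succ →
      f.app (op ⦋2⦌) t ∈ X.thin) →
    (∀ t : (Δ[n + 2] : SSet.{u}) _⦋2⦌,
      t 0 = i.castSucc.castSucc → t 1 = i.castSucc.succ → t 2 = i.succ.succ →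
      g.app (op ⦋2⦌) t ∈ S.thin) →
    ∃ l : Δ[n + 2] ⟶ X.toSSet, Λ[n + 2, i.castSucc.succ].ι ≫ l = f ∧ l ≫ p.toHom = g ∧
      ∀ t : (Δ[n + 2] : SSet.{u}) _⦋2⦌,
        t 0 = i.castSucc.castSucc → t 1 = i.castSucc.succ → t 2 = i.succ.succ →
        l.app (op ⦋2⦌) t ∈ X.thin

theorem generating_le_scaledAnodyne :
    generatingScaledAnodyne.{u} ≤ scaledAnodyne :=
  le_sInf fun _ h => h.2

/-- Maps out of `ofTriangles Y T`. -/
def ofTrianglesDesc {Y : SSet.{u}} {T : Set (Y _⦋2⦌)} {X : ScaledSSet.{u}} (f : Y ⟶ X.toSSet)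
    (h : ∀ t ∈ T, f.app (op ⦋2⦌) t ∈ X.thin) : ofTriangles Y T ⟶ X :=
  { toHom := f
    map_thin := by
      rintro t (ht | ht)
      · exact h t ht
      · exact X.degenerate_subset_thin (SSet.degenerate_le_preimage f 2 ht) }

theorem eq_triangle {n : ℕ} (t : (Δ[n] : SSet.{u}) _⦋2⦌) {a b c : Fin (n + 1)} (hab : a ≤ b)
    (hbc : b ≤ c) : t = stdSimplex.triangle a b c hab hbc ↔ t 0 = a ∧ t 1 = b ∧ t 2 = c := by
  constructor
  · rintro rfl
    exact ⟨rfl, rfl, rfl⟩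
  · rintro ⟨rfl, rfl, rfl⟩
    apply SSet.stdSimplex.ext
    intro i
    fin_cases i <;> rfl

theorem IsWeakSFibration.hasInnerLifts {X S : ScaledSSet.{u}} {p : X ⟶ S}
    (hp : IsWeakSFibration p) : HasInnerLifts p := by
  intro n i f g comm hf hg
  have := hp _ (generating_le_scaledAnodyne _ (generatingScaledAnodyne.inner n i))
  let F := ofTrianglesDesc (T := {t | Λ[n + 2, i.castSucc.succ].ι.app (op ⦋2⦌) t ∈
      ({stdSimplex.triangle i.castSucc.castSucc i.castSucc.succ i.succ.succ
            (Fin.castSucc_le_succ _) (Fin.succ_le_succ_iff.2 (Fin.castSucc_le_succ _))} :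
            Set ((Δ[n+2] : SSet.{u}) _⦋2⦌))}) f (by
    intro t ht
    obtain ⟨h0, h1, h2⟩ := (eq_triangle _ _ _).1 ht
    exact hf t h0 h1 h2)
  let G := ofTrianglesDesc (T :=
      ({stdSimplex.triangle i.castSucc.castSucc i.castSucc.succ i.succ.succ
            (Fin.castSucc_le_succ _) (Fin.succ_le_succ_iff.2 (Fin.castSucc_le_succ _))} :
            Set ((Δ[n+2] : SSet.{u}) _⦋2⦌))) g (by
    intro t ht
    obtain ⟨h0, h1, h2⟩ := (eq_triangle _ _ _).1 ht
    exact hg t h0 h1 h2)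
  have sq : CommSq F (subcomplexInclusion _ _) p G := ⟨Hom.ext comm⟩
  obtain ⟨⟨l, h₁, h₂⟩⟩ := (this.sq_hasLift sq)
  refine ⟨l.toHom, congrArg Hom.toHom h₁, congrArg Hom.toHom h₂, fun t h0 h1 h2 => ?_⟩
  exact l.map_thin _ (Or.inl ((eq_triangle _ _ _).2 ⟨h0, h1, h2⟩))

/-- The terminal scaled simplicial set. -/
def point : ScaledSSet.{u} where
  toSSet := (Functor.const _).obj PUnit
  thin := Set.univ
  degenerate_subset_thin := Set.subset_univ _

/-- The map to the terminal scaled simplicial set. -/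
def toPoint (X : ScaledSSet.{u}) : X ⟶ point :=
  { toHom := { app := fun _ => TypeCat.ofHom fun _ => PUnit.unit }
    map_thin := fun _ _ => Set.mem_univ _ }

theorem hom_point_ext {Y : SSet.{u}} (f g : Y ⟶ point.toSSet) : f = g := by
  ext
  rfl

/-- Extension is lifting against the map to the point, where every triangle is thin. The filling
lemmas for fibrations therefore also apply inside a single ∞-bicategory. -/
theorem IsInfinityBicategory.hasInnerLifts {X : ScaledSSet.{u}} (hX : IsInfinityBicategory X) :
    HasInnerLifts (toPoint X) := by
  refine IsWeakSFibration.hasInnerLifts fun A B i hi => ⟨fun {f g} sq => ?_⟩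
  obtain ⟨l, hl⟩ := hX i hi f
  exact ⟨⟨⟨l, hl, Hom.ext (hom_point_ext _ _)⟩⟩⟩

end ScaledSSet

/-! ### Horns as partial maps. -/

namespace SSet

/-- The sets of vertices of the simplices of the horn `Λ^M_i`. -/
def hornSet {M : ℕ} (i : Fin (M + 1)) : Set (Finset (Fin (M + 1))) :=
  {t | ∃ j, j ≠ i ∧ j ∉ t}

/-- Membership in a horn depends only on the set of vertices, so maps out of horns can be treated as
partial maps. -/
theorem mem_horn_iff_vset {M : ℕ} (i : Fin (M + 1)) {m : SimplexCategoryᵒᵖ}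
    (z : (Δ[M] : SSet.{u}).obj m) :
    z ∈ (horn M i).obj m ↔ vset (stdSimplex.objEquiv z) ∈ hornSet i := by
  induction m using Opposite.rec with | _ m
  induction m using SimplexCategory.rec with | _ m
  rw [mem_horn_iff_notMem_range]
  simp only [hornSet, Set.mem_ofPred_eq, mem_vset, exists_prop]
  rfl

namespace PartialMap

variable {M : ℕ} {X S : SSet.{u}} {i : Fin (M + 1)}

/-- The partial map given by a map out of a horn. -/
def ofHorn (f : (Λ[M, i] : SSet.{u}) ⟶ X) : PartialMap M (hornSet i) X where
  val {m} θ h := f.app (op m) ⟨stdSimplex.objEquiv.symm θ, (mem_horn_iff_vset i _).2 h⟩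
  naturality γ _ _ _ := (NatTrans.naturality_apply f γ.op _).symm

/-- The map out of a horn given by a partial map. -/
def toHorn (φ : PartialMap M (hornSet i) X) : (Λ[M, i] : SSet.{u}) ⟶ X where
  app m := TypeCat.ofHom fun z => φ.val (stdSimplex.objEquiv z.1) ((mem_horn_iff_vset i _).1 z.2)
  naturality l m γ := by
    ext z
    exact (φ.naturality γ.unop (stdSimplex.objEquiv z.1) _ _).symm

end PartialMap

theorem app_eq_map_yonedaEquiv {X : SSet.{u}} {M : ℕ} (l : Δ[M] ⟶ X) {m : SimplexCategoryᵒᵖ}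
    (z : (Δ[M] : SSet.{u}).obj m) :
    l.app m z = X.map (stdSimplex.objEquiv z).op (yonedaEquiv l) := by
  obtain ⟨x, rfl⟩ := yonedaEquiv.symm.surjective l
  rw [Equiv.apply_symm_apply]
  rfl

end SSet

/-! ### Filling an inner horn in a face of a larger simplex. -/

namespace ScaledSSet

open SSet

variable {X S : ScaledSSet.{u}} {p : X ⟶ S}

/-- Lifting of a partial map along an inner horn, in terms of simplices. -/
theorem HasInnerLifts.exists_simplex (hp : HasInnerLifts p) {n : ℕ} (i : Fin (n + 1))
    (φ : PartialMap (n + 2) (hornSet i.castSucc.succ) X.toSSet) (y : S.toSSet.obj (op ⦋n + 2⦌))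
    (hy : φ.Over p.toHom y)
    (hφ : ∀ (θ : ⦋2⦌ ⟶ ⦋n + 2⦌) (h : vset θ ∈ hornSet i.castSucc.succ),
      θ.toOrderHom 0 = i.castSucc.castSucc → θ.toOrderHom 1 = i.castSucc.succ →
      θ.toOrderHom 2 = i.succ.succ → φ.val θ h ∈ X.thin)
    (hthin : ∀ (θ : ⦋2⦌ ⟶ ⦋n + 2⦌), θ.toOrderHom 0 = i.castSucc.castSucc →
      θ.toOrderHom 1 = i.castSucc.succ → θ.toOrderHom 2 = i.succ.succ →
      S.toSSet.map θ.op y ∈ S.thin) :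
    ∃ x : X.toSSet.obj (op ⦋n + 2⦌), p.toHom.app _ x = y ∧
      (∀ ⦃m : SimplexCategory⦄ (θ : m ⟶ ⦋n + 2⦌) (h : vset θ ∈ hornSet i.castSucc.succ),
        φ.val θ h = X.toSSet.map θ.op x) ∧
      ∀ (θ : ⦋2⦌ ⟶ ⦋n + 2⦌), θ.toOrderHom 0 = i.castSucc.castSucc →
        θ.toOrderHom 1 = i.castSucc.succ → θ.toOrderHom 2 = i.succ.succ →
        X.toSSet.map θ.op x ∈ X.thin := by
  obtain ⟨l, h₁, h₂, h₃⟩ := hp n i φ.toHorn (yonedaEquiv.symm y) (by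
      ext m z
      exact hy _ _)
    (fun t h0 h1 h2 => hφ _ _ h0 h1 h2)
    (fun t h0 h1 h2 => hthin (stdSimplex.objEquiv t) h0 h1 h2)
  refine ⟨yonedaEquiv l, ?_, ?_, ?_⟩
  · rw [← yonedaEquiv_comp, h₂, Equiv.apply_symm_apply]
  · intro m θ h
    refine Eq.trans ?_ (app_eq_map_yonedaEquiv l (stdSimplex.objEquiv.symm θ))
    exact (congrArg (fun k : (Λ[n + 2, i.castSucc.succ] : SSet.{u}) ⟶ X.toSSet =>
      k.app (op m) ⟨stdSimplex.objEquiv.symm θ, (mem_horn_iff_vset _ _).2 h⟩) h₁).symm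
  · intro θ h0 h1 h2
    have := h₃ (stdSimplex.objEquiv.symm θ) h0 h1 h2
    rwa [app_eq_map_yonedaEquiv l] at this

/-- The triangle `θ` has vertices `u < v < w` consecutive in `s`. -/
def IsConsecutive {N : ℕ} (s : Finset (Fin (N + 1))) (v : Fin (N + 1)) (θ : ⦋2⦌ ⟶ ⦋N⦌) : Prop :=
  vset θ ⊆ s ∧ θ.toOrderHom 0 < v ∧ θ.toOrderHom 1 = v ∧ v < θ.toOrderHom 2 ∧
    ∀ x ∈ s, θ.toOrderHom 0 < x → x < θ.toOrderHom 2 → x = v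

/-- Extension of a partial map along an inner horn inclusion of a face. -/
theorem HasInnerLifts.exists_fill (hp : HasInnerLifts p) {N : ℕ}
    {F G : Set (Finset (Fin (N + 1)))} (hF : IsLowerSet F) (φ : PartialMap N F X.toSSet)
    (y : S.toSSet.obj (op ⦋N⦌)) (hy : φ.Over p.toHom y)
    (s : Finset (Fin (N + 1))) (v : Fin (N + 1)) (hv : v ∈ s) (hu : ∃ u ∈ s, u < v)
    (hw : ∃ w ∈ s, v < w) (hs : ∀ x ∈ s, x ≠ v → s.erase x ∈ F) (hsv : s.erase v ∉ F)
    (hthin : ∀ θ : ⦋2⦌ ⟶ ⦋N⦌, IsConsecutive s v θ →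
      (∀ h : vset θ ∈ F, φ.val θ h ∈ X.thin) ∧ S.toSSet.map θ.op y ∈ S.thin)
    (hFG : F ⊆ G) (hG : ∀ t ∈ G, t ∉ F → t ⊆ s) :
    ∃ ψ : PartialMap N G X.toSSet, ψ.Extends φ ∧ ψ.Over p.toHom y ∧
      ∀ (θ : ⦋2⦌ ⟶ ⦋N⦌) (h : vset θ ∈ G), IsConsecutive s v θ → ψ.val θ h ∈ X.thin := by
  obtain ⟨u, hus, huv⟩ := hu
  obtain ⟨w, hws, hvw⟩ := hw
  obtain ⟨n, hn⟩ : ∃ n, s.card = n + 2 + 1 := by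
    have h3 : ({u, v, w} : Finset (Fin (N + 1))).card = 3 := by
      rw [Finset.card_eq_three]
      exact ⟨u, v, w, huv.ne, (huv.trans hvw).ne, hvw.ne, rfl⟩
    have h4 : ({u, v, w} : Finset (Fin (N + 1))) ⊆ s := by
      intro x hx
      simp only [Finset.mem_insert, Finset.mem_singleton] at hx
      rcases hx with rfl | rfl | rfl <;> assumption
    have := Finset.card_le_card h4
    exact ⟨s.card - 3, by lia⟩
  let e₀ := s.orderEmbOfFin hn
  have hrange : ∀ x, x ∈ s ↔ ∃ j, e₀ j = x := fun x => by
    rw [← Finset.mem_coe, ← Finset.range_orderEmbOfFin s hn]; rfl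
  let e : ⦋n + 2⦌ ⟶ ⦋N⦌ := SimplexCategory.Hom.mk e₀.toOrderHom
  have he : Function.Injective e.toOrderHom := e₀.injective
  have hse : vset e = s := by
    ext x
    rw [mem_vset, hrange]
    rfl
  obtain ⟨j, hj⟩ := (hrange v).1 hv
  obtain ⟨ju, hju⟩ := (hrange u).1 hus
  obtain ⟨jw, hjw⟩ := (hrange w).1 hws
  have h1 : ju < j := by rwa [← e₀.lt_iff_lt, hj, hju]
  have h2 : j < jw := by rwa [← e₀.lt_iff_lt, hj, hjw]
  obtain ⟨i, rfl⟩ : ∃ i : Fin (n + 1), j = i.castSucc.succ :=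
    ⟨⟨j.1 - 1, by have := jw.2; lia⟩, Fin.ext (by simp; lia)⟩
  -- The face spanned by `s` meets `F` exactly in its horn at `v`: `hs` puts the other faces into
  -- `F`, and `hsv` with `hF` keeps out everything beyond the horn.
  have hhorn : ∀ ⦃m : SimplexCategory⦄ (γ : m ⟶ ⦋n + 2⦌),
      vset (γ ≫ e) ∈ F ↔ vset γ ∈ hornSet i.castSucc.succ := by
    intro m γ
    constructor
    · intro h
      by_contra hγ
      apply hsv
      refine hF ?_ h
      intro x hx
      obtain ⟨hxv, hxs⟩ := Finset.mem_erase.1 hx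
      obtain ⟨k, rfl⟩ := (hrange x).1 hxs
      refine (mem_vset_comp _ _ _).2 ⟨k, ?_, rfl⟩
      by_contra hk
      exact hγ ⟨k, fun hki => hxv (by rw [hki, hj]), hk⟩
    · rintro ⟨k, hk, hkγ⟩
      refine hF ?_ (hs (e₀ k) ((hrange _).2 ⟨k, rfl⟩) (fun h => hk (e₀.injective (h.trans hj.symm))))
      intro x hx
      obtain ⟨k', hk', rfl⟩ := (mem_vset_comp _ _ _).1 hx
      refine Finset.mem_erase.2 ⟨fun h => hkγ ?_, (hrange _).2 ⟨k', rfl⟩⟩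
      rwa [← e₀.injective h]
  have hcons : ∀ θ : ⦋2⦌ ⟶ ⦋n + 2⦌, θ.toOrderHom 0 = i.castSucc.castSucc →
      θ.toOrderHom 1 = i.castSucc.succ → θ.toOrderHom 2 = i.succ.succ →
      IsConsecutive s v (θ ≫ e) := by
    intro θ h0 h1 h2
    have k0 : (θ ≫ e).toOrderHom 0 = e₀ i.castSucc.castSucc := congrArg e₀ h0
    have k1 : (θ ≫ e).toOrderHom 1 = e₀ i.castSucc.succ := congrArg e₀ h1
    have k2 : (θ ≫ e).toOrderHom 2 = e₀ i.succ.succ := congrArg e₀ h2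
    refine ⟨hse ▸ vset_comp_subset _ _, ?_, ?_, ?_, ?_⟩
    · rw [k0, ← hj, e₀.lt_iff_lt, Fin.lt_def]; simp
    · rw [k1, hj]
    · rw [k2, ← hj, e₀.lt_iff_lt, Fin.lt_def]; simp
    · intro x hx hx0 hx2
      obtain ⟨k, rfl⟩ := (hrange x).1 hx
      rw [k0, e₀.lt_iff_lt] at hx0
      rw [k2, e₀.lt_iff_lt] at hx2
      rw [← hj]
      congr 1
      rw [Fin.lt_def] at hx0 hx2
      simp at hx0 hx2
      ext
      simp
      lia
  obtain ⟨x, hx₁, hx₂, hx₃⟩ := hp.exists_simplex i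
    (φ.comp e (hornSet i.castSucc.succ) fun m θ h => (hhorn θ).2 h) (S.toSSet.map e.op y)
    (fun m θ h => (hy _ _).trans (map_op_map_op _ _ _ _).symm)
    (fun θ h h0 h1 h2 => (hthin _ (hcons θ h0 h1 h2)).1 _)
    (fun θ h0 h1 h2 => by
      rw [map_op_map_op]
      exact (hthin _ (hcons θ h0 h1 h2)).2)
  obtain ⟨ψ, hψ₁, hψ₂⟩ := PartialMap.exists_extend hF φ e he x
    (fun m γ h => hx₂ γ ((hhorn γ).1 h)) G hFG (by rwa [hse])
  refine ⟨ψ, hψ₁, ?_, ?_⟩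
  · intro m θ h
    by_cases h' : vset θ ∈ F
    · rw [hψ₁.val_eq θ h h']
      exact hy _ _
    · obtain ⟨γ, rfl⟩ := exists_factor he θ (hse ▸ hG _ h h')
      rw [hψ₂, ← map_op_app, hx₁, map_op_map_op]
  · intro θ h hc
    by_cases h' : vset θ ∈ F
    · rw [hψ₁.val_eq θ h h']
      exact (hthin θ hc).1 h'
    · obtain ⟨γ, rfl⟩ := exists_factor he θ (hse ▸ hG _ h h')
      rw [hψ₂]
      obtain ⟨-, c0, c1, c2, c3⟩ := hc
      have c1' : γ.toOrderHom 1 = i.castSucc.succ := e₀.injective (c1.trans hj.symm)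
      have d0 : γ.toOrderHom 0 < i.castSucc.succ := by
        rw [← e₀.lt_iff_lt, hj]; exact c0
      have d2 : i.castSucc.succ < γ.toOrderHom 2 := by
        rw [← e₀.lt_iff_lt, hj]; exact c2
      have d3 : ∀ k, γ.toOrderHom 0 < k → k < γ.toOrderHom 2 → k = i.castSucc.succ :=
        fun k hk hk' => e₀.injective (by
          rw [hj]
          exact c3 _ ((hrange _).2 ⟨k, rfl⟩) (e₀.lt_iff_lt.2 hk) (e₀.lt_iff_lt.2 hk'))
      -- If an outer vertex of `γ` were not adjacent to the middle one, the adjacent vertex would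
      -- lie strictly between the outer ones, contradicting consecutiveness.
      refine hx₃ γ ?_ c1' ?_
      · by_contra hne
        have := d3 i.castSucc.castSucc (by
          rw [Fin.lt_def] at d0 ⊢
          rw [Fin.ext_iff] at hne
          simp at d0 hne ⊢; lia) (by
          rw [Fin.lt_def] at d2 ⊢
          simp at d2 ⊢; lia)
        simp [Fin.ext_iff] at this
      · by_contra hne
        have := d3 i.succ.succ (by
          rw [Fin.lt_def] at d0 ⊢
          simp at d0 ⊢; lia) (by
          rw [Fin.lt_def] at d2 ⊢
          rw [Fin.ext_iff] at hne
          simp at d2 hne ⊢; lia)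
        simp [Fin.ext_iff] at this

end ScaledSSet

/-! ### Adding the simplices that contain two adjacent vertices and the last one. -/

namespace SSet

theorem mem_vset_two {N : ℕ} (θ : ⦋2⦌ ⟶ ⦋N⦌) (j : Fin (N + 1)) :
    j ∈ vset θ ↔ θ.toOrderHom 0 = j ∨ θ.toOrderHom 1 = j ∨ θ.toOrderHom 2 = j := by
  rw [mem_vset]
  constructor
  · rintro ⟨i, rfl⟩
    change Fin 3 at i
    fin_cases i
    · exact Or.inl rfl
    · exact Or.inr (Or.inl rfl)
    · exact Or.inr (Or.inr rfl)
  · rintro (h | h | h)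
    exacts [⟨_, h⟩, ⟨_, h⟩, ⟨_, h⟩]

/-- Removal of three vertices from a set of vertices. -/
def eraseThree {N : ℕ} (k k' : Fin (N + 1)) (s : Finset (Fin (N + 1))) : Finset (Fin (N + 1)) :=
  ((s.erase k).erase k').erase (Fin.last N)

theorem mem_eraseThree {N : ℕ} (k k' : Fin (N + 1)) (s : Finset (Fin (N + 1)))
    (j : Fin (N + 1)) : j ∈ eraseThree k k' s ↔ j ≠ Fin.last N ∧ j ≠ k' ∧ j ≠ k ∧ j ∈ s := by
  simp [eraseThree]

theorem eraseThree_mono {N : ℕ} (k k' : Fin (N + 1)) {s t : Finset (Fin (N + 1))} (h : s ⊆ t) :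
    eraseThree k k' s ⊆ eraseThree k k' t := by
  intro j
  simp only [mem_eraseThree]
  exact fun ⟨h1, h2, h3, h4⟩ => ⟨h1, h2, h3, h h4⟩

theorem isLowerSet_union_eraseThree {N : ℕ} (k k' : Fin (N + 1))
    {F W : Set (Finset (Fin (N + 1)))} (hF : IsLowerSet F) (hW : IsLowerSet W) :
    IsLowerSet (F ∪ {s | eraseThree k k' s ∈ W}) := by
  rintro s t hts (h | h)
  · exact Or.inl (hF hts h)
  · exact Or.inr (hW (eraseThree_mono k k' hts) h)

/-- The triangle `θ` begins with the edge from `k` to `k'`. -/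
def StartsWith {N : ℕ} (k k' : Fin (N + 1)) (θ : ⦋2⦌ ⟶ ⦋N⦌) : Prop :=
  θ.toOrderHom 0 = k ∧ θ.toOrderHom 1 = k' ∧ k' < θ.toOrderHom 2

end SSet

namespace ScaledSSet

open SSet

variable {X S : ScaledSSet.{u}} {p : X ⟶ S}

/-- The sets `T ∈ U` are treated one at a time, smaller ones first. For each `T` the horn at `k'` of
the simplex `{k, k', last} ∪ T` is filled, which also creates its face opposite `k'`. `W` records
the sets already treated, and `d` counts those that remain. -/
theorem HasInnerLifts.exists_fillPair_aux (hp : HasInnerLifts p) {N : ℕ} {k k' : Fin (N + 1)}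
    (hk : k'.1 = k.1 + 1) (hk' : k' < Fin.last N) {F U : Set (Finset (Fin (N + 1)))}
    (hF : IsLowerSet F) (hU : IsLowerSet U)
    (hUV : ∀ T ∈ U, k ∉ T ∧ k' ∉ T ∧ Fin.last N ∉ T)
    (hbase : ∀ s, Fin.last N ∉ s → s ∈ F) (hpair : ∀ s ∈ F, k ∈ s → Fin.last N ∉ s)
    (hUF : ∀ T ∈ U, insert k' (insert (Fin.last N) T) ∈ F)
    (y : S.toSSet.obj (op ⦋N⦌))
    (hthin : ∀ θ : ⦋2⦌ ⟶ ⦋N⦌, StartsWith k k' θ → S.toSSet.map θ.op y ∈ S.thin) (d : ℕ) :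
    ∀ W : Set (Finset (Fin (N + 1))), IsLowerSet W → W ⊆ U → (U \ W).ncard = d →
      ∀ φ : PartialMap N (F ∪ {s | eraseThree k k' s ∈ W}) X.toSSet, φ.Over p.toHom y →
      (∀ (θ : ⦋2⦌ ⟶ ⦋N⦌) (h : vset θ ∈ F ∪ {s | eraseThree k k' s ∈ W}), StartsWith k k' θ →
        φ.val θ h ∈ X.thin) →
      ∃ ψ : PartialMap N (F ∪ {s | eraseThree k k' s ∈ U}) X.toSSet, ψ.Extends φ ∧
        ψ.Over p.toHom y ∧ ∀ (θ : ⦋2⦌ ⟶ ⦋N⦌) (h : vset θ ∈ F ∪ {s | eraseThree k k' s ∈ U}),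
          StartsWith k k' θ → ψ.val θ h ∈ X.thin := by
  induction d with
  | zero =>
    intro W hW hWU hd φ hφ hφthin
    have hUW : U = W := by
      have := (Set.ncard_eq_zero (Set.toFinite _)).1 hd
      exact Set.Subset.antisymm (Set.sdiff_eq_empty.1 this) hWU
    subst hUW
    exact ⟨φ, fun m θ h => ⟨h, rfl⟩, hφ, hφthin⟩
  | succ d ih =>
    intro W hW hWU hd φ hφ hφthin
    -- Minimality of `T` places all its proper subsets in `W`, so the faces opposite vertices of `T`
    -- are already defined.
    obtain ⟨T, hT⟩ := (Set.toFinite (U \ W)).exists_minimal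
      (Set.nonempty_of_ncard_ne_zero (by rw [hd]; exact Nat.succ_ne_zero d))
    obtain ⟨⟨hTU, hTW⟩, hmin⟩ := hT
    have hTlt : ∀ T' ⊆ T, T' ≠ T → T' ∈ W := by
      intro T' h hne
      by_contra h'
      exact hne (le_antisymm h (hmin ⟨hU h hTU, h'⟩ h))
    have hW' : IsLowerSet (insert T W) := by
      rintro s t hts (rfl | hs)
      · by_cases h : t = s
        · exact Or.inl h
        · exact Or.inr (hTlt t hts h)
      · exact Or.inr (hW hts hs)
    obtain ⟨hkT, hkT', hlT⟩ := hUV T hTU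
    have hkk' : k ≠ k' := fun h => by rw [h] at hk; lia
    have hkl : k ≠ Fin.last N := fun h => by
      rw [Fin.lt_def] at hk'; rw [h] at hk; simp at hk hk'; lia
    have hkl' : k' ≠ Fin.last N := hk'.ne
    obtain ⟨s, mem_s⟩ : ∃ s : Finset (Fin (N + 1)),
        ∀ x, x ∈ s ↔ x = k ∨ x = k' ∨ x = Fin.last N ∨ x ∈ T :=
      ⟨insert k (insert k' (insert (Fin.last N) T)), by simp⟩
    have hsk : eraseThree k k' (s.erase k') = T := by
      ext z
      rw [mem_eraseThree, Finset.mem_erase, mem_s]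
      grind
    have hsT : ∀ t, t ∉ F ∪ {s | eraseThree k k' s ∈ W} →
        t ∈ F ∪ {s | eraseThree k k' s ∈ insert T W} → eraseThree k k' t = T := by
      rintro t ht (h | h | h)
      · exact absurd (Or.inl h) ht
      · exact h
      · exact absurd (Or.inr h) ht
    obtain ⟨ψ, hψ₁, hψ₂, hψ₃⟩ := hp.exists_fill (G := F ∪ {s | eraseThree k k' s ∈ insert T W})
      (isLowerSet_union_eraseThree k k' hF hW) φ y hφ s k'
      (by simp [mem_s]) ⟨k, by simp [mem_s], by rw [Fin.lt_def]; lia⟩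
      ⟨Fin.last N, by simp [mem_s], hk'⟩
      -- The face opposite the last vertex comes from `hbase`, the one opposite `k` from `hUF`, and
      -- those opposite vertices of `T` from earlier stages.
      (by
        intro x hx hxk'
        by_cases hxl : x = Fin.last N
        · subst hxl
          exact Or.inl (hbase _ (by simp))
        by_cases hxk : x = k
        · refine Or.inl (hF ?_ (hUF T hTU))
          intro z hz
          rw [Finset.mem_erase, mem_s, hxk] at hz
          simp only [Finset.mem_insert]
          tauto
        · have hxT : x ∈ T := by
            rw [mem_s] at hx; tauto
          refine Or.inr (hW ?_ (hTlt (T.erase x) (Finset.erase_subset _ _)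
            (fun h => by rw [← h] at hxT; simp at hxT)))
          intro z hz
          rw [mem_eraseThree, Finset.mem_erase, mem_s] at hz
          rw [Finset.mem_erase]
          tauto)
      (by
        rintro (h | h)
        · refine hpair _ h ?_ ?_
          · rw [Finset.mem_erase, mem_s]; tauto
          · rw [Finset.mem_erase, mem_s]; tauto
        · apply hTW
          rw [← hsk]
          exact h)
      (by
        intro θ ⟨_, c0, c1, c2, c3⟩
        have hθ : StartsWith k k' θ := by
          refine ⟨?_, c1, c2⟩
          by_contra hne
          refine hkk' (c3 k (by simp [mem_s]) ?_ (lt_trans (by rw [Fin.lt_def]; lia) c2))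
          rw [Fin.lt_def] at c0 ⊢
          rw [Fin.ext_iff] at hne
          lia
        exact ⟨fun h => hφthin θ h hθ, hthin θ hθ⟩)
      (by
        rintro t (h | h)
        · exact Or.inl h
        · exact Or.inr (Or.inr h))
      (by
        intro t ht ht'
        rw [← Finset.coe_subset]
        intro z hz
        have := hsT t ht' ht
        rw [Finset.mem_coe, mem_s, ← this, mem_eraseThree]
        rw [Finset.mem_coe] at hz
        tauto)
    obtain ⟨χ, hχ₁, hχ₂, hχ₃⟩ := ih (insert T W) hW' (Set.insert_subset hTU hWU)
      (by
        have : U \ insert T W = (U \ W) \ {T} := by ext; simp; tauto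
        have hT' : T ∈ U \ W := ⟨hTU, hTW⟩
        rw [this, Set.ncard_sdiff_singleton_of_mem hT', hd]
        rfl)
      ψ hψ₂ (by
        intro θ h hθ
        by_cases h' : vset θ ∈ F ∪ {s | eraseThree k k' s ∈ W}
        · rw [hψ₁.val_eq θ h h']
          exact hφthin θ h' hθ
        · have hθT := hsT _ h' h
          obtain ⟨h0, h1, h2⟩ := hθ
          -- A new triangle beginning with `k, k'` must end at the last vertex, since otherwise it
          -- lies in `F` by `hbase`. This forces `T = ∅`: the triangle is the one filling a `Λ^2_1`,
          -- and the filler is thin.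
          have hl : θ.toOrderHom 2 = Fin.last N := by
            by_contra hl
            refine h' (Or.inl (hbase _ ?_))
            rw [mem_vset_two, h0, h1]
            tauto
          have hTe : T = ∅ := by
            ext z
            rw [← hθT, mem_eraseThree, mem_vset_two, h0, h1, hl]
            simp
            tauto
          refine hψ₃ θ h ⟨?_, ?_, h1, h2, ?_⟩
          · intro z hz
            rw [mem_vset_two, h0, h1, hl] at hz
            rw [mem_s]
            rcases hz with rfl | rfl | rfl <;> simp
          · rw [h0, Fin.lt_def]; lia
          · intro x hx hx0 hx2
            rw [mem_s, hTe] at hx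
            rw [h0] at hx0
            rw [hl] at hx2
            rcases hx with rfl | rfl | rfl | hx
            · exact absurd hx0 (lt_irrefl _)
            · rfl
            · exact absurd hx2 (lt_irrefl _)
            · simp at hx)
    exact ⟨χ, hχ₁.trans hψ₁, hχ₂, hχ₃⟩

/-- Extension of a partial map along all simplices which contain consecutive vertices `k` and
`k'`, given their faces opposite to `k` and opposite to the last vertex. -/
theorem HasInnerLifts.exists_fillPair (hp : HasInnerLifts p) {N : ℕ} {k k' : Fin (N + 1)}
    (hk : k'.1 = k.1 + 1) (hk' : k' < Fin.last N) {F U : Set (Finset (Fin (N + 1)))}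
    (hF : IsLowerSet F) (hU : IsLowerSet U)
    (hUV : ∀ T ∈ U, k ∉ T ∧ k' ∉ T ∧ Fin.last N ∉ T)
    (hbase : ∀ s, Fin.last N ∉ s → s ∈ F) (hpair : ∀ s ∈ F, k ∈ s → Fin.last N ∉ s)
    (hUF : ∀ T ∈ U, insert k' (insert (Fin.last N) T) ∈ F)
    (y : S.toSSet.obj (op ⦋N⦌))
    (hthin : ∀ θ : ⦋2⦌ ⟶ ⦋N⦌, StartsWith k k' θ → S.toSSet.map θ.op y ∈ S.thin)
    (φ : PartialMap N F X.toSSet) (hφ : φ.Over p.toHom y)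
    (hφthin : ∀ (θ : ⦋2⦌ ⟶ ⦋N⦌) (h : vset θ ∈ F), StartsWith k k' θ → φ.val θ h ∈ X.thin) :
    ∃ ψ : PartialMap N (F ∪ {s | eraseThree k k' s ∈ U}) X.toSSet, ψ.Extends φ ∧
      ψ.Over p.toHom y ∧ ∀ (θ : ⦋2⦌ ⟶ ⦋N⦌) (h : vset θ ∈ F ∪ {s | eraseThree k k' s ∈ U}),
        StartsWith k k' θ → ψ.val θ h ∈ X.thin := by
  have hF' : F ∪ {s | eraseThree k k' s ∈ (∅ : Set (Finset (Fin (N + 1))))} ⊆ F := by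
    rintro s (h | h)
    exacts [h, absurd h (Set.notMem_empty _)]
  obtain ⟨ψ, h₁, h₂, h₃⟩ := hp.exists_fillPair_aux hk hk' hF hU hUV hbase hpair hUF y hthin _ ∅
    isLowerSet_empty (Set.empty_subset _) rfl (φ.restrict _ hF') (fun m θ h => hφ θ (hF' h))
    (fun θ h hθ => hφthin θ (hF' h) hθ)
  exact ⟨ψ, h₁.trans fun m θ h => ⟨Or.inl h, rfl⟩, h₂, h₃⟩

end ScaledSSet

/-! ### Outer horns with prescribed last face, and doubling a vertex. -/

namespace SSet

theorem map_mem_degenerate {X : SSet.{u}} {M : ℕ} (γ : ⦋2⦌ ⟶ ⦋M⦌) (x : X _⦋M⦌)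
    (h : γ.toOrderHom 0 = γ.toOrderHom 1 ∨ γ.toOrderHom 1 = γ.toOrderHom 2) :
    X.map γ.op x ∈ X.degenerate 2 := by
  have hγ : stdSimplex.objEquiv.symm γ ∈ (Δ[M] : SSet.{u}).degenerate 2 := by
    by_contra hn
    have hinj := (stdSimplex.mem_nonDegenerate_iff_strictMono _).1 hn
    rcases h with h | h
    · exact absurd (hinj (show (0 : Fin 3) < 1 by decide)) (by
        rw [stdSimplex.objEquiv_symm_apply, stdSimplex.objEquiv_symm_apply]
        exact fun h' => h'.ne h)
    · exact absurd (hinj (show (1 : Fin 3) < 2 by decide)) (by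
        rw [stdSimplex.objEquiv_symm_apply, stdSimplex.objEquiv_symm_apply]
        exact fun h' => h'.ne h)
  exact degenerate_app_apply hγ (yonedaEquiv.symm x)

theorem δ_val {n : ℕ} (i : Fin (n + 2)) (j : Fin (n + 1)) :
    ((SimplexCategory.δ i).toOrderHom j : Fin (n + 2)).1 = if j.1 < i.1 then j.1 else j.1 + 1 := by
  change (i.succAbove j).1 = _
  simp only [Fin.succAbove, Fin.lt_def, Fin.val_castSucc]
  split_ifs <;> simp

theorem σ_val {n : ℕ} (i : Fin (n + 1)) (j : Fin (n + 2)) :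
    ((SimplexCategory.σ i).toOrderHom j : Fin (n + 1)).1 = if j.1 ≤ i.1 then j.1 else j.1 - 1 := by
  change (i.predAbove j).1 = _
  simp only [Fin.predAbove, Fin.lt_def, Fin.val_castSucc]
  split_ifs <;> first | lia | simp

theorem δ_injective {n : ℕ} (i : Fin (n + 2)) :
    Function.Injective (SimplexCategory.δ i).toOrderHom :=
  Fin.succAbove_right_injective

theorem mem_vset_δ {n : ℕ} (i j : Fin (n + 2)) : j ∈ vset (SimplexCategory.δ i) ↔ j ≠ i := by
  rw [mem_vset]
  exact Fin.exists_succAbove_eq_iff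

theorem exists_factor_δ {n : ℕ} (i : Fin (n + 2)) {m : SimplexCategory} (θ : m ⟶ ⦋n + 1⦌)
    (h : i ∉ vset θ) : ∃ γ : m ⟶ ⦋n⦌, γ ≫ SimplexCategory.δ i = θ :=
  exists_factor (δ_injective i) θ fun j hj => (mem_vset_δ i j).2 fun hji => h (hji ▸ hj)

theorem notMem_vset_comp_δ {n : ℕ} (i : Fin (n + 2)) {m : SimplexCategory} (γ : m ⟶ ⦋n⦌) :
    i ∉ vset (γ ≫ SimplexCategory.δ i) :=
  fun h => (mem_vset_δ i i).1 (vset_comp_subset _ _ h) rfl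

/-- As `i ≠ 0`, the face map fixes `0`; the horn at `0` of the face opposite `i` thus consists of
the simplices of that face missing a further nonzero vertex. -/
theorem vset_mem_hornSet_iff {n : ℕ} (i : Fin (n + 2)) (hi : i ≠ 0) {m : SimplexCategory}
    (γ : m ⟶ ⦋n⦌) : vset γ ∈ hornSet 0 ↔
      ∃ j, j ≠ 0 ∧ j ≠ i ∧ j ∉ vset (γ ≫ SimplexCategory.δ i) := by
  have hzero : (SimplexCategory.δ i).toOrderHom (0 : Fin (n + 1)) = 0 := by
    have : i.1 ≠ 0 := fun h => hi (Fin.ext h)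
    ext
    rw [δ_val, if_pos (by simp; lia)]
    simp
  constructor
  · rintro ⟨j, hj, hjγ⟩
    refine ⟨(SimplexCategory.δ i).toOrderHom j, ?_, (mem_vset_δ i _).1 ((mem_vset _ _).2 ⟨j, rfl⟩),
      ?_⟩
    · exact fun h => hj (δ_injective i (h.trans hzero.symm))
    · intro h
      obtain ⟨j', hj', h⟩ := (mem_vset_comp _ _ _).1 h
      exact hjγ (δ_injective i h ▸ hj')
  · rintro ⟨j, hj, hji, hjγ⟩
    obtain ⟨j', rfl⟩ := (mem_vset _ _).1 ((mem_vset_δ i j).2 hji)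
    refine ⟨j', ?_, fun h => hjγ ((mem_vset_comp _ _ _).2 ⟨j', h, rfl⟩)⟩
    rintro rfl
    exact hj hzero

/-- All lifting problems against `p` for the horn `Λ^{n+3}_0` whose last face is `h` and whose
restriction to `Δ^{0,1,n+3}` is `σ` have solutions. -/
def HornFills {X S : SSet.{u}} (p : X ⟶ S) {n : ℕ} (h : X _⦋n + 2⦌) (σ : X _⦋2⦌) : Prop :=
  ∀ (f : PartialMap (n + 3) (hornSet 0) X) (y : S _⦋n + 3⦌), f.Over p y →
    (∀ hm, f.val (SimplexCategory.δ (Fin.last (n + 3))) hm = h) →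
    (∀ (θ : ⦋2⦌ ⟶ ⦋n + 3⦌) (hm : vset θ ∈ hornSet 0), θ.toOrderHom 0 = 0 → θ.toOrderHom 1 = 1 →
      θ.toOrderHom 2 = Fin.last (n + 3) → f.val θ hm = σ) →
    ∃ x : X _⦋n + 3⦌, p.app _ x = y ∧ ∀ ⦃m : SimplexCategory⦄ (θ : m ⟶ ⦋n + 3⦌)
      (hm : vset θ ∈ hornSet 0), f.val θ hm = X.map θ.op x

/-- A partial map on `Δ^{n+3}`, transported along the face opposite to `k`, and extended to
the last face by duplicating the vertex `k - 1` of its own last face. -/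
theorem PartialMap.exists_duplicate {X : SSet.{u}} {n : ℕ} {k : Fin (n + 5)} (i : Fin (n + 3))
    (hi : k.1 = i.1 + 1)
    {G : Set (Finset (Fin (n + 4)))} (f : PartialMap (n + 3) G X)
    {F : Set (Finset (Fin (n + 5)))} (hF : IsLowerSet F)
    (hpair : ∀ t ∈ F, k ∈ t → Fin.last (n + 4) ∉ t)
    (hFG : ∀ ⦃m : SimplexCategory⦄ (γ : m ⟶ ⦋n + 3⦌),
      vset (γ ≫ SimplexCategory.δ k) ∈ F → vset γ ∈ G)
    (h : X _⦋n + 2⦌) (hm : vset (SimplexCategory.δ (Fin.last (n + 3))) ∈ G)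
    (hfh : f.val (SimplexCategory.δ (Fin.last (n + 3))) hm = h) :
    ∃ φ : PartialMap (n + 4) F X,
      (∀ ⦃m : SimplexCategory⦄ (γ : m ⟶ ⦋n + 3⦌) (hγ : vset (γ ≫ SimplexCategory.δ k) ∈ F),
        φ.val (γ ≫ SimplexCategory.δ k) hγ = f.val γ (hFG γ hγ)) ∧
      (∀ ⦃m : SimplexCategory⦄ (γ : m ⟶ ⦋n + 3⦌)
        (hγ : vset (γ ≫ SimplexCategory.δ (Fin.last (n + 4))) ∈ F),
        φ.val (γ ≫ SimplexCategory.δ (Fin.last (n + 4))) hγ =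
          X.map (γ ≫ SimplexCategory.σ i).op h) := by
  have hk : k ≠ Fin.last (n + 4) := fun h => by
    have h2 := i.2
    rw [h] at hi
    simp at hi
    lia
  have hF₀ : IsLowerSet {t | t ∈ F ∧ k ∉ t} :=
    fun s t hts hs => ⟨hF hts hs.1, fun hk => hs.2 (hts hk)⟩
  -- Agreement on the overlap of the face opposite `k` with the last face: away from `k = i + 1`,
  -- collapsing `k` onto `i` and then reinserting a gap at `k` changes nothing.
  have hcomm : ∀ ⦃m : SimplexCategory⦄ (γ : m ⟶ ⦋n + 3⦌),
      k ∉ vset (γ ≫ SimplexCategory.δ (Fin.last (n + 4))) →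
      ((γ ≫ SimplexCategory.σ i) ≫ SimplexCategory.δ (Fin.last (n + 3))) ≫ SimplexCategory.δ k =
        γ ≫ SimplexCategory.δ (Fin.last (n + 4)) := by
    intro m γ hγ
    ext x : 3
    apply Fin.ext
    have h1 : ((γ ≫ SimplexCategory.δ (Fin.last (n + 4))).toOrderHom x).1 =
        (γ.toOrderHom x).1 := by
      refine (δ_val _ (γ.toOrderHom x)).trans (if_pos ?_)
      simp
    have h2 : ((γ ≫ SimplexCategory.δ (Fin.last (n + 4))).toOrderHom x).1 ≠ k.1 := fun h2 =>
      hγ ((mem_vset _ _).2 ⟨x, Fin.ext h2⟩)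
    rw [h1] at h2
    refine Eq.trans ?_ h1.symm
    have h3 := σ_val i (γ.toOrderHom x)
    have h4 := δ_val (Fin.last (n + 3)) ((SimplexCategory.σ i).toOrderHom (γ.toOrderHom x))
    rw [if_pos (by simp)] at h4
    refine (δ_val k _).trans ?_
    rw [h3] at h4
    change (if ((SimplexCategory.δ (Fin.last (n + 3))).toOrderHom
      ((SimplexCategory.σ i).toOrderHom (γ.toOrderHom x))).1 < k.1 then
      ((SimplexCategory.δ (Fin.last (n + 3))).toOrderHom
      ((SimplexCategory.σ i).toOrderHom (γ.toOrderHom x))).1 else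
      ((SimplexCategory.δ (Fin.last (n + 3))).toOrderHom
      ((SimplexCategory.σ i).toOrderHom (γ.toOrderHom x))).1 + 1) = _
    rw [h4]
    split_ifs <;> lia
  obtain ⟨φ₀, hφ₀⟩ := f.exists_push (F := {t | t ∈ F ∧ k ∉ t}) (SimplexCategory.δ k)
    (δ_injective k) (fun s hs j hj => (mem_vset_δ k j).2 fun hjk => hs.2 (hjk ▸ hj))
    (fun m γ h => hFG γ h.1)
  obtain ⟨φ, hφ₁, hφ₂⟩ := PartialMap.exists_extend hF₀ φ₀
    (SimplexCategory.δ (Fin.last (n + 4))) (δ_injective _) (X.map (SimplexCategory.σ i).op h) (by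
      intro m γ hγ
      have hc := hcomm γ hγ.2
      have hγ' : vset (((γ ≫ SimplexCategory.σ i) ≫ SimplexCategory.δ (Fin.last (n + 3))) ≫
          SimplexCategory.δ k) ∈ {t | t ∈ F ∧ k ∉ t} := hc ▸ hγ
      rw [φ₀.val_congr hc.symm, hφ₀ _ hγ', ← f.naturality _ _ hm, hfh, map_op_map_op])
    F (fun t ht => ht.1)
    (fun t ht ht' j hj => (mem_vset_δ _ j).2 (by
      rintro rfl
      exact hpair t ht (by by_contra h; exact ht' ⟨ht, h⟩) hj))
  refine ⟨φ, fun m γ hγ => ?_, fun m γ hγ => ?_⟩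
  · rw [hφ₁.val_eq _ hγ ⟨hγ, notMem_vset_comp_δ _ _⟩, hφ₀]
  · rw [hφ₂, map_op_map_op]

end SSet

/-! ### Replacing a vertex of the last face by its predecessor. -/

namespace ScaledSSet

open SSet

variable {X S : ScaledSSet.{u}} {p : X ⟶ S}

theorem StartsWith.of_comp {n : ℕ} {k k' : Fin (n + 2)} {γ : ⦋2⦌ ⟶ ⦋n⦌}
    (h : StartsWith k k' (γ ≫ SimplexCategory.δ (Fin.last (n + 1)))) :
    (γ.toOrderHom 0).1 = k.1 ∧ (γ.toOrderHom 1).1 = k'.1 ∧ k'.1 < (γ.toOrderHom 2).1 := by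
  have hv : ∀ x, ((γ ≫ SimplexCategory.δ (Fin.last (n + 1))).toOrderHom x).1 =
      (γ.toOrderHom x).1 := fun x =>
    (δ_val _ (γ.toOrderHom x)).trans (if_pos (γ.toOrderHom x).2)
  obtain ⟨h0, h1, h2⟩ := h
  rw [Fin.lt_def, hv] at h2
  exact ⟨by rw [← hv, h0], by rw [← hv, h1], h2⟩

/-- In `S`, a simplex `y` can be extended along the degenerate simplex obtained by duplicating a
vertex of its last face. -/
theorem HasInnerLifts.exists_duplicate (hS : HasInnerLifts (toPoint S)) {n : ℕ}
    {k k' : Fin (n + 5)} (i : Fin (n + 3)) (hi : k.1 = i.1 + 1) (hk : k'.1 = k.1 + 1)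
    (hk' : k' < Fin.last (n + 4)) (y : S.toSSet _⦋n + 3⦌) (h : S.toSSet _⦋n + 2⦌)
    (hy : S.toSSet.map (SimplexCategory.δ (Fin.last (n + 3))).op y = h)
    (hdeg : ∀ γ : ⦋2⦌ ⟶ ⦋n + 3⦌, (γ.toOrderHom 0).1 = k.1 → (γ.toOrderHom 1).1 = k'.1 →
      k'.1 < (γ.toOrderHom 2).1 →
      S.toSSet.map (γ ≫ SimplexCategory.σ i).op h ∈ S.toSSet.degenerate 2) :
    ∃ z : S.toSSet _⦋n + 4⦌, S.toSSet.map (SimplexCategory.δ k).op z = y ∧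
      S.toSSet.map (SimplexCategory.δ (Fin.last (n + 4))).op z =
        S.toSSet.map (SimplexCategory.σ i).op h ∧
      ∀ θ : ⦋2⦌ ⟶ ⦋n + 4⦌, StartsWith k k' θ → S.toSSet.map θ.op z ∈ S.thin := by
  -- `F` is the union of the last face and the face opposite `k`. With `U` taken as large as
  -- possible, the filling reaches the whole simplex.
  let F : Set (Finset (Fin (n + 5))) := {t | Fin.last (n + 4) ∉ t ∨ k ∉ t}
  let U : Set (Finset (Fin (n + 5))) := {T | k ∉ T ∧ k' ∉ T ∧ Fin.last (n + 4) ∉ T}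
  have hF : IsLowerSet F := fun s t hts hs => hs.imp (fun h h' => h (hts h')) fun h h' => h (hts h')
  have hU : IsLowerSet U := fun s t hts hs =>
    ⟨fun h => hs.1 (hts h), fun h => hs.2.1 (hts h), fun h => hs.2.2 (hts h)⟩
  have hpair : ∀ t ∈ F, k ∈ t → Fin.last (n + 4) ∉ t := by
    rintro t (ht | ht) hkt
    exacts [ht, absurd hkt ht]
  have hlast : ∀ ⦃m : SimplexCategory⦄ (γ : m ⟶ ⦋n + 3⦌),
      vset (γ ≫ SimplexCategory.δ (Fin.last (n + 4))) ∈ F :=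
    fun m γ => Or.inl (notMem_vset_comp_δ _ _)
  have hkF : ∀ ⦃m : SimplexCategory⦄ (γ : m ⟶ ⦋n + 3⦌), vset (γ ≫ SimplexCategory.δ k) ∈ F :=
    fun m γ => Or.inr (notMem_vset_comp_δ _ _)
  obtain ⟨φ, hφ₁, hφ₂⟩ := (PartialMap.ofSimplex y Set.univ).exists_duplicate i hi hF hpair
    (fun m γ _ => Set.mem_univ _) h (Set.mem_univ _) hy
  obtain ⟨ψ, hψ₁, -, hψ₂⟩ := hS.exists_fillPair hk hk' hF hU (fun T hT => hT)
    (fun s hs => Or.inl hs) hpair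
    (by
      rintro T ⟨hT, -, -⟩
      refine Or.inr ?_
      simp only [Finset.mem_insert, not_or]
      refine ⟨?_, ?_, hT⟩
      · rw [Fin.ext_iff]; lia
      · rw [Fin.ext_iff]; rw [Fin.lt_def] at hk'; lia)
    PUnit.unit (fun _ _ => Set.mem_univ _) φ (fun _ _ _ => rfl)
    (by
      intro θ hθ hs
      obtain ⟨γ, rfl⟩ := exists_factor_δ (Fin.last (n + 4)) θ
        (hpair _ hθ ((mem_vset _ _).2 ⟨0, hs.1⟩))
      rw [hφ₂]
      obtain ⟨h0, h1, h2⟩ := StartsWith.of_comp hs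
      exact S.degenerate_subset_thin (hdeg γ h0 h1 h2))
  have huniv : ∀ t, t ∈ F ∪ {s | eraseThree k k' s ∈ U} := by
    intro t
    refine Or.inr ⟨?_, ?_, ?_⟩ <;> simp [mem_eraseThree]
  have hval : ∀ ⦃m : SimplexCategory⦄ (θ : m ⟶ ⦋n + 4⦌),
      ψ.val θ (huniv _) = S.toSSet.map θ.op (ψ.val (𝟙 _) (huniv _)) :=
    fun m θ => ψ.exists_simplex _ θ _
  refine ⟨ψ.val (𝟙 _) (huniv _), ?_, ?_, ?_⟩
  · rw [← hval, hψ₁.val_eq _ _ (by simpa using hkF (𝟙 _)),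
      φ.val_congr (Category.id_comp _).symm, hφ₁]
    simp [PartialMap.ofSimplex]
  · rw [← hval, hψ₁.val_eq _ _ (by simpa using hlast (𝟙 _)),
      φ.val_congr (Category.id_comp _).symm, hφ₂, Category.id_comp]
  · intro θ hθ
    rw [← hval]
    exact hψ₂ θ _ hθ

theorem IsConsecutive.eq {N : ℕ} {s : Finset (Fin (N + 1))} {v : Fin (N + 1)}
    {θ : ⦋2⦌ ⟶ ⦋N⦌} (h : IsConsecutive s v θ) {u w : Fin (N + 1)} (hu : u ∈ s) (hw : w ∈ s)
    (huv : v.1 = u.1 + 1) (hvw : w.1 = v.1 + 1) :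
    θ.toOrderHom 0 = u ∧ θ.toOrderHom 1 = v ∧ θ.toOrderHom 2 = w := by
  obtain ⟨-, h0, h1, h2, h3⟩ := h
  refine ⟨?_, h1, ?_⟩
  · by_contra hne
    have := h3 u hu (by rw [Fin.lt_def] at h0 ⊢; rw [Fin.ext_iff] at hne; lia)
      (by rw [Fin.lt_def] at h2 ⊢; lia)
    rw [this] at huv
    lia
  · by_contra hne
    have := h3 w hw (by rw [Fin.lt_def] at h0 ⊢; lia)
      (by rw [Fin.lt_def] at h2 ⊢; rw [Fin.ext_iff] at hne; lia)
    rw [this] at hvw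
    lia

/-- If the last face `h` is constant from the vertex `i + 1` on, then solvability of horn
extension problems can be tested after replacing the vertex `i + 1` by the vertex `i`. -/
theorem HasInnerLifts.hornFills_of_duplicate (hp : HasInnerLifts p)
    (hS : HasInnerLifts (toPoint S)) {n : ℕ} (i : Fin (n + 3)) (hi : 1 ≤ i.1)
    (hi' : i.1 ≤ n + 1) (h : X.toSSet _⦋n + 2⦌) (σ : X.toSSet _⦋2⦌)
    (hdeg : ∀ γ : ⦋2⦌ ⟶ ⦋n + 3⦌, (γ.toOrderHom 0).1 = i.1 + 1 → (γ.toOrderHom 1).1 = i.1 + 2 →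
      i.1 + 2 < (γ.toOrderHom 2).1 →
      X.toSSet.map (γ ≫ SimplexCategory.σ i).op h ∈ X.toSSet.degenerate 2)
    (hfill : HornFills p.toHom (X.toSSet.map
      (SimplexCategory.δ (⟨i.1 + 2, by lia⟩ : Fin (n + 4)) ≫ SimplexCategory.σ i).op h) σ) :
    HornFills p.toHom h σ := by
  intro f y hfy hfh hfσ
  let k : Fin (n + 5) := ⟨i.1 + 1, by lia⟩
  let k' : Fin (n + 5) := ⟨i.1 + 2, by lia⟩
  have hk0 : k ≠ 0 := fun h => by simpa [k] using congrArg Fin.val h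
  have hk0' : k' ≠ 0 := fun h => by simpa [k'] using congrArg Fin.val h
  have hkk' : k ≠ k' := fun h => by simpa [k, k'] using congrArg Fin.val h
  have hkl : k ≠ Fin.last (n + 4) := fun h => by
    have := congrArg Fin.val h
    simp [k] at this
    lia
  have hkl' : k' ≠ Fin.last (n + 4) := fun h => by
    have := congrArg Fin.val h
    simp [k'] at this
    lia
  have hl0 : Fin.last (n + 4) ≠ 0 := Fin.last_pos.ne'
  have hm : vset (SimplexCategory.δ (Fin.last (n + 3))) ∈ hornSet (0 : Fin (n + 4)) :=
    ⟨Fin.last (n + 3), Fin.last_pos.ne', fun h => (mem_vset_δ _ _).1 h rfl⟩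
  obtain ⟨z, hz₁, hz₂, hz₃⟩ := hS.exists_duplicate (k := k) (k' := k') i rfl rfl
    (by rw [Fin.lt_def]; simp [k']; lia) y (p.toHom.app _ h)
    (by rw [← hfy _ hm, hfh])
    (fun γ h0 h1 h2 => by
      have := degenerate_app_apply (hdeg γ h0 h1 h2) p.toHom
      rwa [← map_op_app] at this)
  -- the part of `Δ^{n+4}` given by the last face and the horn in the face opposite to `k`
  let F : Set (Finset (Fin (n + 5))) :=
    {t | Fin.last (n + 4) ∉ t ∨ (k ∉ t ∧ ∃ j, j ≠ 0 ∧ j ≠ k ∧ j ∉ t)}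
  -- Here `{k, k', last} ∪ T` must still miss a nonzero vertex, so that its face opposite `k` lies
  -- in the given horn.
  let U : Set (Finset (Fin (n + 5))) := {T | (k ∉ T ∧ k' ∉ T ∧ Fin.last (n + 4) ∉ T) ∧
    ∃ j, j ≠ 0 ∧ j ≠ k ∧ j ≠ k' ∧ j ≠ Fin.last (n + 4) ∧ j ∉ T}
  have hF : IsLowerSet F := by
    rintro s t hts (hs | ⟨hs, j, hj₁, hj₂, hj₃⟩)
    · exact Or.inl fun h => hs (hts h)
    · exact Or.inr ⟨fun h => hs (hts h), j, hj₁, hj₂, fun h => hj₃ (hts h)⟩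
  have hU : IsLowerSet U := by
    rintro s t hts ⟨⟨h1, h2, h3⟩, j, hj₁, hj₂, hj₃, hj₄, hj₅⟩
    exact ⟨⟨fun h => h1 (hts h), fun h => h2 (hts h), fun h => h3 (hts h)⟩,
      j, hj₁, hj₂, hj₃, hj₄, fun h => hj₅ (hts h)⟩
  have hpair : ∀ t ∈ F, k ∈ t → Fin.last (n + 4) ∉ t := by
    rintro t (ht | ⟨ht, -⟩) hkt
    exacts [ht, absurd hkt ht]
  have hlast : ∀ ⦃m : SimplexCategory⦄ (γ : m ⟶ ⦋n + 3⦌),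
      vset (γ ≫ SimplexCategory.δ (Fin.last (n + 4))) ∈ F :=
    fun m γ => Or.inl (notMem_vset_comp_δ _ _)
  have hFhorn : ∀ ⦃m : SimplexCategory⦄ (γ : m ⟶ ⦋n + 3⦌),
      vset (γ ≫ SimplexCategory.δ k) ∈ F → vset γ ∈ hornSet 0 := by
    rintro m γ (hγ | ⟨-, hγ⟩)
    · exact (vset_mem_hornSet_iff k hk0 γ).2 ⟨_, hl0, hkl.symm, hγ⟩
    · exact (vset_mem_hornSet_iff k hk0 γ).2 hγ
  have hhornF : ∀ ⦃m : SimplexCategory⦄ (γ : m ⟶ ⦋n + 3⦌), vset γ ∈ hornSet 0 →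
      vset (γ ≫ SimplexCategory.δ k) ∈ F :=
    fun m γ hγ => Or.inr ⟨notMem_vset_comp_δ _ _, (vset_mem_hornSet_iff k hk0 γ).1 hγ⟩
  obtain ⟨φ, hφ₁, hφ₂⟩ := f.exists_duplicate (k := k) i rfl hF hpair hFhorn h hm (hfh hm)
  have hφz : φ.Over p.toHom z := by
    rintro m θ (hθ | hθ)
    · obtain ⟨γ, rfl⟩ := exists_factor_δ _ θ hθ
      rw [hφ₂, ← map_op_map_op, ← map_op_app, ← map_op_app, ← hz₂, map_op_map_op]
    · obtain ⟨γ, rfl⟩ := exists_factor_δ _ θ hθ.1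
      rw [hφ₁, hfy, ← hz₁, map_op_map_op]
  obtain ⟨ψ, hψ₁, hψ₂, -⟩ := hp.exists_fillPair (k := k) (k' := k') rfl
    (by rw [Fin.lt_def]; simp [k']; lia) hF hU (fun T hT => hT.1)
    (fun s hs => Or.inl hs) hpair
    (by
      rintro T ⟨⟨hT, -, -⟩, j, hj₁, hj₂, hj₃, hj₄, hj₅⟩
      refine Or.inr ⟨?_, j, hj₁, hj₂, ?_⟩ <;>
      · simp only [Finset.mem_insert, not_or]
        tauto)
    z hz₃ φ hφz
    (by
      intro θ hθ hs
      obtain ⟨γ, rfl⟩ := exists_factor_δ (Fin.last (n + 4)) θ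
        (hpair _ hθ ((mem_vset _ _).2 ⟨0, hs.1⟩))
      rw [hφ₂]
      obtain ⟨h0, h1, h2⟩ := StartsWith.of_comp hs
      exact X.degenerate_subset_thin (hdeg γ h0 h1 h2))
  -- All faces opposite vertices other than `0`, `k`, `k'` are now defined.
  let F₁ : Set (Finset (Fin (n + 5))) := F ∪ {s | eraseThree k k' s ∈ U}
  have hF₁ : IsLowerSet F₁ := isLowerSet_union_eraseThree k k' hF hU
  have mem_F₁ : ∀ t j, j ≠ 0 → j ≠ k → j ≠ k' → j ∉ t → t ∈ F₁ := by
    intro t j hj₁ hj₂ hj₃ hj₅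
    by_cases hj₄ : j = Fin.last (n + 4)
    · subst hj₄
      exact Or.inl (Or.inl hj₅)
    · refine Or.inr ⟨?_, j, hj₁, hj₂, hj₃, hj₄, ?_⟩ <;> simp only [mem_eraseThree] <;> tauto
  have hF₁_cases : ∀ t ∈ F₁, Fin.last (n + 4) ∈ t →
      (k ∉ t ∧ ∃ j, j ≠ 0 ∧ j ≠ k ∧ j ∉ t) ∨ ∃ j, j ≠ 0 ∧ j ≠ k ∧ j ≠ k' ∧ j ∉ t := by
    rintro t ((ht | ht) | ⟨-, j, hj₁, hj₂, hj₃, hj₄, hj₅⟩) hl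
    · exact absurd hl ht
    · exact Or.inl ht
    · refine Or.inr ⟨j, hj₁, hj₂, hj₃, fun h => hj₅ ?_⟩
      rw [mem_eraseThree]
      exact ⟨hj₄, hj₃, hj₂, h⟩
  -- The face opposite `k'` meets `F₁` in precisely its horn at `0`, to which `hfill` applies.
  have hF₁horn : ∀ ⦃m : SimplexCategory⦄ (γ : m ⟶ ⦋n + 3⦌),
      vset (γ ≫ SimplexCategory.δ k') ∈ F₁ ↔ vset γ ∈ hornSet 0 := by
    intro m γ
    rw [vset_mem_hornSet_iff k' hk0' γ]
    constructor
    · intro ht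
      by_cases hl : Fin.last (n + 4) ∈ vset (γ ≫ SimplexCategory.δ k')
      · rcases hF₁_cases _ ht hl with ⟨hk, -⟩ | ⟨j, hj₁, hj₂, hj₃, hj₄⟩
        · exact ⟨k, hk0, hkk', hk⟩
        · exact ⟨j, hj₁, hj₃, hj₄⟩
      · exact ⟨_, hl0, hkl'.symm, hl⟩
    · rintro ⟨j, hj₁, hj₂, hj₃⟩
      by_cases hjk : j = k
      · subst hjk
        exact Or.inl (Or.inr ⟨hj₃, k', hk0', hkk'.symm, notMem_vset_comp_δ _ _⟩)
      · exact mem_F₁ _ j hj₁ hjk hj₂ hj₃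
  obtain ⟨x', hx'₁, hx'₂⟩ := hfill
    (ψ.comp (SimplexCategory.δ k') (hornSet 0) fun m θ hθ => (hF₁horn θ).2 hθ)
    (S.toSSet.map (SimplexCategory.δ k').op z)
    (fun m θ hθ => (hψ₂ _ _).trans (map_op_map_op _ _ _ _).symm)
    (by
      intro hm'
      have hc : SimplexCategory.δ (Fin.last (n + 3)) ≫ SimplexCategory.δ k' =
          SimplexCategory.δ (⟨i.1 + 2, by lia⟩ : Fin (n + 4)) ≫
            SimplexCategory.δ (Fin.last (n + 4)) := by
        ext x : 3
        apply Fin.ext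
        refine (δ_val _ _).trans (Eq.trans ?_ (δ_val _ _).symm)
        rw [δ_val, δ_val]
        have := x.2
        simp [k'] at this ⊢
        split_ifs <;> lia
      refine (ψ.val_congr hc _).trans ((hψ₁.val_eq _ _ (hlast _)).trans (hφ₂ _ _)))
    (by
      intro θ hθ h0 h1 h2
      -- Both faces contain the same triangle on `0`, `1` and the last vertex, because `1 < k < k' <
      -- last`; so the new horn also restricts to `σ`.
      have hc : θ ≫ SimplexCategory.δ k' = θ ≫ SimplexCategory.δ k := by
        ext x : 3
        apply Fin.ext
        refine (δ_val _ _).trans (Eq.trans ?_ (δ_val _ _).symm)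
        change Fin 3 at x
        fin_cases x
        · change (if (θ.toOrderHom 0).1 < _ then _ else (θ.toOrderHom 0).1 + 1) =
            if (θ.toOrderHom 0).1 < _ then _ else (θ.toOrderHom 0).1 + 1
          rw [h0]
          simp [k, k']
        · change (if (θ.toOrderHom 1).1 < _ then _ else (θ.toOrderHom 1).1 + 1) =
            if (θ.toOrderHom 1).1 < _ then _ else (θ.toOrderHom 1).1 + 1
          rw [h1]
          simp [k, k']
          lia
        · change (if (θ.toOrderHom 2).1 < _ then _ else (θ.toOrderHom 2).1 + 1) =
            if (θ.toOrderHom 2).1 < _ then _ else (θ.toOrderHom 2).1 + 1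
          rw [h2]
          simp [k, k']
          lia
      refine (ψ.val_congr hc _).trans ((hψ₁.val_eq _ _ (hhornF _ hθ)).trans
        ((hφ₁ _ _).trans (hfσ θ _ h0 h1 h2))))
  let F₂ : Set (Finset (Fin (n + 5))) := F₁ ∪ {t | k' ∉ t}
  have hF₂ : IsLowerSet F₂ := by
    rintro s t hts (hs | hs)
    · exact Or.inl (hF₁ hts hs)
    · exact Or.inr fun h => hs (hts h)
  obtain ⟨χ, hχ₁, hχ₂⟩ := PartialMap.exists_extend hF₁ ψ (SimplexCategory.δ k') (δ_injective _) x'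
    (fun m γ hγ => hx'₂ γ ((hF₁horn γ).1 hγ)) F₂ Set.subset_union_left
    (by
      rintro t (ht | ht) ht' j hj
      · exact absurd ht ht'
      · exact (mem_vset_δ _ _).2 fun hjk => ht (hjk ▸ hj))
  have hχz : χ.Over p.toHom z := by
    rintro m θ hθ
    rcases id hθ with hθ' | hθ'
    · rw [hχ₁.val_eq _ hθ hθ', hψ₂]
    · obtain ⟨γ, rfl⟩ := exists_factor_δ _ θ hθ'
      rw [hχ₂, ← map_op_app, hx'₁, map_op_map_op]
  -- The consecutive triangle is `{i, k, k'}`. It lies in the last face, where its first edge is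
  -- collapsed by `σ i`.
  have hthin : ∀ {s : Finset (Fin (n + 5))} (θ : ⦋2⦌ ⟶ ⦋n + 4⦌), IsConsecutive s k θ →
      (⟨i.1, by lia⟩ : Fin (n + 5)) ∈ s → k' ∈ s →
      ∃ hθ : vset θ ∈ F, φ.val θ hθ ∈ X.thin := by
    intro s θ hθ hi hk's
    obtain ⟨h0, h1, h2⟩ := hθ.eq hi hk's rfl rfl
    have hlt : Fin.last (n + 4) ∉ vset θ := by
      rw [mem_vset_two, h0, h1, h2, Fin.ext_iff, Fin.ext_iff, Fin.ext_iff]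
      simp [k, k']
      lia
    obtain ⟨γ, rfl⟩ := exists_factor_δ _ θ hlt
    refine ⟨Or.inl hlt, ?_⟩
    rw [hφ₂]
    refine X.degenerate_subset_thin (map_mem_degenerate _ _ (Or.inl ?_))
    have hv : ∀ x, ((γ ≫ SimplexCategory.δ (Fin.last (n + 4))).toOrderHom x).1 =
        (γ.toOrderHom x).1 := fun x =>
      (δ_val _ (γ.toOrderHom x)).trans (if_pos (by simp))
    apply Fin.ext
    refine (σ_val _ _).trans (Eq.trans ?_ (σ_val _ _).symm)
    rw [← hv, ← hv, h0, h1]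
    simp [k]
  have hi₀ : (⟨i.1, by lia⟩ : Fin (n + 5)) ∈ Finset.univ.erase 0 :=
    Finset.mem_erase.2 ⟨fun h => by
      have := congrArg Fin.val h
      simp at this
      lia, Finset.mem_univ _⟩
  -- In the face opposite `0`, only the subface opposite `k` is missing. The vertex `k` is inner
  -- there because `i ≥ 1`.
  obtain ⟨χ', hχ'₁, hχ'₂, -⟩ := hp.exists_fill
    (G := F₂ ∪ {t | t ⊆ Finset.univ.erase 0}) hF₂ χ z hχz (Finset.univ.erase 0) k (by simp [hk0])
    ⟨⟨i.1, by lia⟩, hi₀, Fin.lt_def.2 (Nat.lt_succ_self i.1)⟩ ⟨k', by simp [hk0'], Fin.lt_def.2 (Nat.lt_succ_self (i.1 + 1))⟩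
    (by
      intro x hx hxk
      by_cases hxk' : x = k'
      · exact Or.inr (by simp [hxk'])
      · exact Or.inl (mem_F₁ _ x (Finset.mem_erase.1 hx).1 hxk hxk' (by simp)))
    (by
      rintro (ht | ht)
      · rcases hF₁_cases _ ht (by simp [hkl.symm, hl0]) with ⟨-, j, h1, h2, h3⟩ | ⟨j, h1, h2, -, h3⟩
        <;> simp [h1, h2] at h3
      · simp [hk0', hkk'.symm] at ht)
    (by
      intro θ hθ
      obtain ⟨hF', ht⟩ := hthin θ hθ hi₀ (Finset.mem_erase.2 ⟨hk0', Finset.mem_univ _⟩)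
      refine ⟨fun hθ' => ?_, ?_⟩
      · rwa [(hχ₁.trans hψ₁).val_eq θ hθ' hF']
      · rw [← hφz θ hF']
        exact p.map_thin _ ht)
    Set.subset_union_left
    (by
      rintro t (ht | ht) ht'
      exacts [absurd ht ht', ht])
  have hF₃ : IsLowerSet (F₂ ∪ {t | t ⊆ Finset.univ.erase 0}) := by
    rintro s t hts (hs | hs)
    · exact Or.inl (hF₂ hts hs)
    · exact Or.inr (hts.trans hs)
  -- Only the face opposite `k` is still missing; the filler of this inner horn provides it, and it
  -- is the simplex sought.
  obtain ⟨ω, hω₁, hω₂, -⟩ := hp.exists_fill (G := Set.univ) hF₃ χ' z hχ'₂ Finset.univ k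
    (Finset.mem_univ _) ⟨⟨i.1, by lia⟩, Finset.mem_univ _, Fin.lt_def.2 (Nat.lt_succ_self i.1)⟩
    ⟨k', Finset.mem_univ _, Fin.lt_def.2 (Nat.lt_succ_self (i.1 + 1))⟩
    (by
      intro x _ hxk
      by_cases hx0 : x = 0
      · exact Or.inr (by rw [hx0]; exact Finset.Subset.refl _)
      by_cases hxk' : x = k'
      · exact Or.inl (Or.inr (by simp [hxk']))
      · exact Or.inl (Or.inl (mem_F₁ _ x hx0 hxk hxk' (by simp))))
    (by
      rintro ((ht | ht) | ht)
      · rcases hF₁_cases _ ht (by simp [hkl.symm]) with ⟨-, j, h1, h2, h3⟩ | ⟨j, h1, h2, -, h3⟩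
        <;> simp [h2] at h3
      · simp [hkk'.symm] at ht
      · have : (0 : Fin (n + 5)) ∈ Finset.univ.erase (0 : Fin (n + 5)) :=
          ht (by simp [hk0.symm])
        simp at this)
    (by
      intro θ hθ
      obtain ⟨hF', ht⟩ := hthin θ hθ (Finset.mem_univ _) (Finset.mem_univ _)
      refine ⟨fun hθ' => ?_, ?_⟩
      · rwa [((hχ'₁.trans hχ₁).trans hψ₁).val_eq θ hθ' hF']
      · rw [← hφz θ hF']
        exact p.map_thin _ ht)
    (Set.subset_univ _) (fun t _ _ => Finset.subset_univ _)
  refine ⟨X.toSSet.map (SimplexCategory.δ k).op (ω.val (𝟙 _) (Set.mem_univ _)), ?_, ?_⟩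
  · rw [← map_op_app, hω₂, map_op_map_op, Category.comp_id, hz₁]
  · intro m θ hm
    rw [map_op_map_op, ← ω.exists_simplex _ _ (Set.mem_univ _),
      (((hω₁.trans hχ'₁).trans hχ₁).trans hψ₁).val_eq _ _ (hhornF _ hm), hφ₁]

end ScaledSSet

/-! ### Cones, mapping spaces, and horns with constant last face. -/

namespace SSet

theorem map_constSimplex {X : SSet.{u}} {l m : SimplexCategory} (γ : l ⟶ m) (a : X _⦋0⦌) :
    X.map γ.op (constSimplex X (op m) a) = constSimplex X (op l) a :=
  map_op_map_op X _ _ a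

theorem app_constSimplex {X S : SSet.{u}} (p : X ⟶ S) (m : SimplexCategory) (a : X _⦋0⦌) :
    p.app (op m) (constSimplex X (op m) a) = constSimplex S (op m) (p.app (op ⦋0⦌) a) :=
  (map_op_app p _ a).symm

theorem isCoCartesianTriangle_of_hornFills {X S : SSet.{u}} {p : X ⟶ S} {σ : X _⦋2⦌}
    (H : ∀ (n : ℕ) (h : X _⦋n + 2⦌), HornFills p h σ) : IsCoCartesianTriangle p σ := by
  intro n f g comm hσ
  obtain ⟨x, hx₁, hx₂⟩ := H n _ (PartialMap.ofHorn f) (yonedaEquiv g)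
    (by
      intro m θ hθ
      refine Eq.trans ?_ (app_eq_map_yonedaEquiv g (stdSimplex.objEquiv.symm θ))
      exact congrArg (fun k : (Λ[n + 3, 0] : SSet.{u}) ⟶ S =>
        k.app (op m) ⟨stdSimplex.objEquiv.symm θ, (mem_horn_iff_vset _ _).2 hθ⟩) comm)
    (fun hm => show _ = (PartialMap.ofHorn f).val _ ⟨Fin.last (n + 3), Fin.last_pos.ne',
      fun h => (mem_vset_δ _ _).1 h rfl⟩ from rfl)
    (by
      intro θ hm h0 h1 h2
      rw [← hσ]
      refine congrArg (f.app (op ⦋2⦌)) (Subtype.ext ?_)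
      exact (ScaledSSet.eq_triangle (stdSimplex.objEquiv.symm θ) (Fin.zero_le _)
        (Fin.le_last _)).2 ⟨h0, h1, h2⟩)
  refine ⟨yonedaEquiv.symm x, ?_, ?_⟩
  · ext m z
    exact (hx₂ (stdSimplex.objEquiv z.1) ((mem_horn_iff_vset _ _).1 z.2)).symm
  · rw [yonedaEquiv_symm_comp, hx₁, Equiv.symm_apply_apply]

/-- The map `θ ⋆ [0]`. -/
def coneHom {l m : SimplexCategory} (γ : l ⟶ m) : ⦋l.len + 1⦌ ⟶ ⦋m.len + 1⦌ := joinPoint.map γ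

/-- The map `θ ⋆ [0]`, for a simplex `θ` of `Δ^N`. -/
def coneMap {N : ℕ} {m : SimplexCategory} (θ : m ⟶ ⦋N⦌) : ⦋m.len + 1⦌ ⟶ ⦋N + 1⦌ :=
  joinPoint.map θ

/-- The inclusion of the base of a cone. -/
def coneInl (m : SimplexCategory) : m ⟶ ⦋m.len + 1⦌ := joinPointInl.app m

/-- The inclusion of the vertex of a cone. -/
def coneInr (m : SimplexCategory) : ⦋0⦌ ⟶ ⦋m.len + 1⦌ := joinPointInr m

/-- The last vertex of `Δ^N`. -/
def lastVertex (N : ℕ) : ⦋0⦌ ⟶ ⦋N⦌ := SimplexCategory.const ⦋0⦌ ⦋N⦌ (Fin.last N)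

theorem coneMap_comp {N : ℕ} {l m : SimplexCategory} (γ : l ⟶ m) (θ : m ⟶ ⦋N⦌) :
    coneMap (γ ≫ θ) = coneHom γ ≫ coneMap θ := joinPoint.map_comp γ θ

theorem joinPointInl_app (n : ℕ) :
    joinPointInl.app ⦋n⦌ = SimplexCategory.δ (Fin.last (n + 1)) := by
  ext i : 3
  exact (Fin.succAbove_last_apply i).symm

theorem coneInl_comp {N : ℕ} {m : SimplexCategory} (θ : m ⟶ ⦋N⦌) :
    coneInl m ≫ coneMap θ = θ ≫ SimplexCategory.δ (Fin.last (N + 1)) := by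
  rw [← joinPointInl_app]
  exact (joinPointInl.naturality θ).symm

theorem coneInr_comp {N : ℕ} {m : SimplexCategory} (θ : m ⟶ ⦋N⦌) :
    coneInr m ≫ coneMap θ = lastVertex (N + 1) := joinPointInr_comp θ

theorem coneMap_δ {n : ℕ} (j : Fin (n + 2)) :
    coneMap (SimplexCategory.δ j) = SimplexCategory.δ j.castSucc := by
  ext i : 3
  change joinPointHom (SimplexCategory.δ j) i = j.castSucc.succAbove i
  induction i using Fin.lastCases with
  | last =>
    refine (joinPointHom_last _).trans ?_
    exact ((Fin.succAbove_of_le_castSucc _ _ (Fin.castSucc_le_castSucc_iff.2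
      (Fin.le_last j))).trans (Fin.succ_last _)).symm
  | cast i => exact (joinPointHom_castSucc _ i).trans Fin.castSucc_succAbove_castSucc.symm

theorem mem_mappingSpace_iff {X : SSet.{u}} {a b : X _⦋0⦌} {m : SimplexCategory}
    (x : X _⦋m.len + 1⦌) : x ∈ (mappingSpace X a b).obj (op m) ↔
      X.map (coneInl m).op x = constSimplex X (op m) a ∧ X.map (coneInr m).op x = b :=
  Iff.rfl

theorem mem_mappingSpace_mk_iff {X : SSet.{u}} {a b : X _⦋0⦌} {n : ℕ}
    (x : X _⦋n + 1⦌) : x ∈ (mappingSpace X a b).obj (op ⦋n⦌) ↔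
      X.map (SimplexCategory.δ (Fin.last (n + 1))).op x = constSimplex X (op ⦋n⦌) a ∧
        X.map (lastVertex (n + 1)).op x = b := by
  rw [← joinPointInl_app]
  exact Iff.rfl

theorem vset_coneMap {n : ℕ} {m : SimplexCategory} (θ : m ⟶ ⦋n + 2⦌)
    (hθ : vset θ ∈ hornSet 0) : vset (coneMap θ) ∈ hornSet 0 := by
  obtain ⟨j, hj, hjθ⟩ := hθ
  obtain ⟨γ, rfl⟩ := exists_factor_δ j θ hjθ
  refine ⟨j.castSucc, fun h => hj (Fin.castSucc_injective _ h), ?_⟩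
  rw [coneMap_comp, coneMap_δ]
  exact notMem_vset_comp_δ _ _

theorem coneMap_apply {N : ℕ} (θ : ⦋1⦌ ⟶ ⦋N + 1⦌) (h0 : θ.toOrderHom 0 = 0)
    (h1 : θ.toOrderHom 1 = 1) :
    (coneMap θ : ⦋2⦌ ⟶ ⦋N + 2⦌).toOrderHom 0 = 0 ∧
      (coneMap θ : ⦋2⦌ ⟶ ⦋N + 2⦌).toOrderHom 1 = 1 ∧
      (coneMap θ : ⦋2⦌ ⟶ ⦋N + 2⦌).toOrderHom 2 = Fin.last (N + 2) := by
  refine ⟨?_, ?_, joinPointHom_last θ⟩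
  · exact (joinPointHom_castSucc θ 0).trans (by rw [h0]; rfl)
  · exact (joinPointHom_castSucc θ 1).trans (by rw [h1]; rfl)

theorem vset_δ_mem_hornSet {n : ℕ} (j : Fin (n + 2)) (hj : j ≠ 0) {m : SimplexCategory}
    (γ : m ⟶ ⦋n⦌) : vset (γ ≫ SimplexCategory.δ j) ∈ hornSet 0 :=
  ⟨j, hj, notMem_vset_comp_δ _ _⟩

theorem vset_δ_mem_hornSet' {n : ℕ} (j : Fin (n + 2)) (hj : j ≠ 0) :
    vset (SimplexCategory.δ j) ∈ hornSet 0 :=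
  ⟨j, hj, fun h => (mem_vset_δ _ _).1 h rfl⟩

theorem lastVertex_mem_hornSet (n : ℕ) : vset (lastVertex (n + 2)) ∈ hornSet 0 := by
  refine ⟨1, by simp, fun h => ?_⟩
  obtain ⟨i, hi⟩ := (mem_vset _ _).1 h
  have hi' : (Fin.last (n + 2)).1 = (1 : Fin (n + 3)).1 := congrArg Fin.val hi
  simp at hi'

/-- The edge `Δ^{0,1}` of `Δ^{n+2}`. -/
def firstEdge (n : ℕ) : ⦋1⦌ ⟶ ⦋n + 2⦌ := stdSimplex.objEquiv (hornEdge.{0} n).1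

theorem firstEdge_mem_hornSet (n : ℕ) : vset (firstEdge n) ∈ hornSet 0 :=
  (mem_horn_iff_vset _ _).1 (hornEdge.{0} n).2

section

variable {X S : SSet.{u}} {p : X ⟶ S} {σ : X _⦋2⦌} {hσ : IsLeftDegenerate σ} {a b : X _⦋0⦌}
  {ha : triangleVertex σ 0 = a} {hb : triangleVertex σ 2 = b}

/-- Such a horn is the cone on a horn in `X(a, b)`: constancy of the last face gives the condition
on the base, and `σ` contains the cone point, which is therefore `b`. -/
theorem hornFills_const
    (H : IsCoCartesianEdge (mappingSpaceMap p a b) (mappingSpaceEdge σ hσ ha hb)) (n : ℕ) :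
    HornFills p (constSimplex X (op ⦋n + 2⦌) a) σ := by
  intro f y hfy hfa hfσ
  have hinl := vset_δ_mem_hornSet' (Fin.last (n + 3)) Fin.last_pos.ne'
  have hinr := lastVertex_mem_hornSet (n + 1)
  have hfe : f.val (coneMap (firstEdge n)) (vset_coneMap _ (firstEdge_mem_hornSet n)) = σ := by
    obtain ⟨h0, h1, h2⟩ := coneMap_apply (firstEdge n) rfl rfl
    exact hfσ _ _ h0 h1 h2
  have hfb : f.val (lastVertex (n + 3)) hinr = b := by
    have hc : coneInr ⦋1⦌ ≫ coneMap (firstEdge n) = lastVertex (n + 3) := coneInr_comp _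
    refine Eq.trans ?_ hb
    refine (f.val_congr hc.symm _).trans ?_
    refine (f.naturality (coneInr ⦋1⦌) (coneMap (firstEdge n))
      (vset_coneMap _ (firstEdge_mem_hornSet n)) _).symm.trans ?_
    exact congrArg (X.map (coneInr ⦋1⦌).op) hfe
  have hF : ∀ ⦃m : SimplexCategory⦄ (θ : m ⟶ ⦋n + 2⦌) (hθ : vset θ ∈ hornSet 0),
      f.val (coneMap θ) (vset_coneMap θ hθ) ∈ (mappingSpace X a b).obj (op m) := by
    intro m θ hθ
    have hm := vset_δ_mem_hornSet (Fin.last (n + 3)) Fin.last_pos.ne' θ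
    rw [mem_mappingSpace_iff]
    constructor
    · rw [f.naturality (coneInl m) (coneMap θ) _ (by rw [coneInl_comp]; exact hm),
        f.val_congr (coneInl_comp θ), ← f.naturality _ _ hinl, hfa, map_constSimplex]
    · rw [f.naturality (coneInr m) (coneMap θ) _ (by rw [coneInr_comp]; exact hinr),
        f.val_congr (coneInr_comp θ), hfb]
  let F : (Λ[n + 2, 0] : SSet.{u}) ⟶ (mappingSpace X a b : SSet.{u}) :=
    PartialMap.toHorn
      { val := fun θ hθ => ⟨_, hF θ hθ⟩
        naturality := fun γ θ h h' => Subtype.ext (by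
          refine (f.naturality (coneHom γ) (coneMap θ) _
            (by rw [← coneMap_comp]; exact vset_coneMap _ h')).trans ?_
          exact f.val_congr (coneMap_comp γ θ).symm _) }
  have hy : y ∈
      (mappingSpace S (p.app (op ⦋0⦌) a) (p.app (op ⦋0⦌) b)).obj (op ⦋n + 2⦌) := by
    rw [mem_mappingSpace_mk_iff]
    constructor
    · rw [← hfy _ hinl, hfa, app_constSimplex]
    · rw [← hfy _ hinr, hfb]
  obtain ⟨l, hl₁, hl₂⟩ := H n F (yonedaEquiv.symm ⟨y, hy⟩) (by
      ext m z
      apply Subtype.ext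
      exact hfy _ _)
    (Subtype.ext hfe)
  obtain ⟨e, hel⟩ : ∃ e : X _⦋n + 3⦌, e = (yonedaEquiv l).1 := ⟨_, rfl⟩
  have he := (mem_mappingSpace_mk_iff _).1 (yonedaEquiv l).2
  rw [← hel] at he
  have hval : ∀ ⦃m : SimplexCategory⦄ (θ : m ⟶ ⦋n + 2⦌) (hθ : vset θ ∈ hornSet 0),
      f.val (coneMap θ) (vset_coneMap θ hθ) = X.map (coneMap θ).op e := by
    intro m θ hθ
    subst hel
    have h1 := congrArg (fun k : (Λ[n + 2, 0] : SSet.{u}) ⟶ (mappingSpace X a b : SSet.{u}) =>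
      (k.app (op m) ⟨stdSimplex.objEquiv.symm θ, (mem_horn_iff_vset _ _).2 hθ⟩).1) hl₁
    refine Eq.trans h1.symm ?_
    exact congrArg Subtype.val (app_eq_map_yonedaEquiv l (stdSimplex.objEquiv.symm θ))
  refine ⟨e, ?_, ?_⟩
  · have h1 : yonedaEquiv (l ≫ mappingSpaceMap p a b) = ⟨y, hy⟩ :=
      (congrArg yonedaEquiv hl₂).trans (Equiv.apply_symm_apply _ _)
    subst hel
    exact congrArg Subtype.val h1
  · intro m θ hm
    obtain ⟨j, hj, hjθ⟩ := id hm
    obtain ⟨γ, rfl⟩ := exists_factor_δ j θ hjθ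
    -- The last face is constant on both sides; every other face is a cone, so there agreement comes
    -- from the filler in `X(a, b)`.
    induction j using Fin.lastCases with
    | last => rw [← f.naturality _ _ hinl, hfa, ← map_op_map_op, he.1]
    | cast j =>
      have hj' : j ≠ 0 := fun h => hj (by rw [h]; rfl)
      have h3 := hval (SimplexCategory.δ j) (vset_δ_mem_hornSet' j hj')
      rw [f.val_congr (coneMap_δ j)] at h3
      replace h3 := h3.trans (congrArg (fun k : _ ⟶ ⦋n + 3⦌ => X.map k.op e) (coneMap_δ j))
      rw [← f.naturality _ _ (vset_δ_mem_hornSet' _ hj), h3, map_op_map_op]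

end

end SSet

/-! ### Reduction to a constant last face. -/

namespace ScaledSSet

open SSet

variable {X S : ScaledSSet.{u}} {p : X ⟶ S}

/-- Horn extension problems whose last face is `α^* h` can be solved, provided that they can be
solved when the last face is `β^* h` for the map `β` sending `0` to `0` and all other
vertices to `1`. -/
theorem HasInnerLifts.hornFills_map (hp : HasInnerLifts p) (hS : HasInnerLifts (toPoint S))
    {n : ℕ} (h : X.toSSet _⦋n + 2⦌) (σ : X.toSSet _⦋2⦌)
    (hβ : ∀ β : ⦋n + 2⦌ ⟶ ⦋n + 2⦌, β.toOrderHom 0 = 0 → (∀ j, 1 ≤ j → β.toOrderHom j = 1) →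
      HornFills p.toHom (X.toSSet.map β.op h) σ) (d : ℕ) :
    ∀ α : ⦋n + 2⦌ ⟶ ⦋n + 2⦌, α.toOrderHom 0 = 0 → α.toOrderHom 1 = 1 →
      ∑ j : Fin (n + 3), (α.toOrderHom j).1 = d → HornFills p.toHom (X.toSSet.map α.op h) σ := by
  induction d using Nat.strong_induction_on with
  | _ d ih =>
    intro α h0 h1 hd
    let L : Fin (n + 3) := Fin.last (n + 2)
    let P : ℕ → Prop := fun k => ∀ j : Fin (n + 3), k ≤ j.1 → α.toOrderHom j = α.toOrderHom L
    have hP : ∃ k, P k := ⟨n + 2, fun j hj => congrArg _ (Fin.ext (by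
      have := j.2
      simp [L]
      lia))⟩
    classical
    -- `k` is the least vertex from which `α` is constant. If `k ≤ 1`, then `α` is already of the
    -- form `β`.
    let k := Nat.find hP
    have hk : P k := Nat.find_spec hP
    have hkn : k ≤ n + 2 := Nat.find_min' hP fun j hj => congrArg _ (Fin.ext (by
      have := j.2
      simp [L]
      lia))
    by_cases hk1 : k ≤ 1
    · refine hβ α h0 fun j hj => ?_
      have hj' : 1 ≤ j.1 := by simpa [Fin.le_def] using hj
      have e1 : α.toOrderHom 1 = α.toOrderHom L := hk 1 (by simpa using hk1)
      exact (hk j (by lia)).trans (e1.symm.trans h1)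
    · obtain ⟨i₀, hi₀⟩ : ∃ i₀, k = i₀ + 1 := ⟨k - 1, by lia⟩
      have hnot : ¬ P i₀ := Nat.find_min hP (by change i₀ < k; lia)
      let i : Fin (n + 3) := ⟨i₀, by lia⟩
      have hne : α.toOrderHom i ≠ α.toOrderHom L := by
        intro hi
        refine hnot fun j hj => ?_
        by_cases hj' : k ≤ j.1
        · exact hk j hj'
        · have : j = i := Fin.ext (by change j.1 = i₀; lia)
          rw [this, hi]
      -- `e` lowers `k = i₀ + 1` to `i₀` and fixes the other vertices. Since `α` jumps between `i₀`
      -- and `k`, composing with `e` strictly lowers the sum of values.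
      let e : ⦋n + 2⦌ ⟶ ⦋n + 2⦌ :=
        SimplexCategory.δ (⟨i.1 + 2, by change i₀ + 2 < n + 4; lia⟩ : Fin (n + 4)) ≫
          SimplexCategory.σ i
      have he : ∀ j : Fin (n + 3), (e.toOrderHom j).1 = if j.1 = i₀ + 1 then i₀ else j.1 := by
        intro j
        have h2 := δ_val (⟨i.1 + 2, by change i₀ + 2 < n + 4; lia⟩ : Fin (n + 4)) j
        refine (σ_val i _).trans ?_
        rw [h2]
        simp only [i]
        split_ifs <;> lia
      refine hp.hornFills_of_duplicate hS i (by change 1 ≤ i₀; lia) (by change i₀ ≤ n + 1; lia)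
        _ σ ?_ ?_
      -- After `σ i`, the last two vertices of the triangle are at least `k`, where `α` is constant;
      -- the triangle is degenerate.
      · intro γ _ g1 g2
        rw [map_op_map_op]
        refine map_mem_degenerate _ _ (Or.inr ?_)
        have h1' := σ_val i (γ.toOrderHom 1)
        have h2' := σ_val i (γ.toOrderHom 2)
        have e1 : α.toOrderHom ((SimplexCategory.σ i).toOrderHom (γ.toOrderHom 1)) =
            α.toOrderHom L := hk _ (by
          rw [h1', g1]; simp only [i]; split_ifs <;> lia)
        have e2 : α.toOrderHom ((SimplexCategory.σ i).toOrderHom (γ.toOrderHom 2)) =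
            α.toOrderHom L := hk _ (by
          rw [h2']; simp only [i] at g2 ⊢; split_ifs <;> lia)
        exact e1.trans e2.symm
      · rw [map_op_map_op]
        have he0 : e.toOrderHom (0 : Fin (n + 3)) = 0 := Fin.ext (by rw [he]; simp)
        have he1 : e.toOrderHom (1 : Fin (n + 3)) = 1 := Fin.ext (by
          rw [he, if_neg]
          simp
          lia)
        have hle : ∀ j : Fin (n + 3), α.toOrderHom (e.toOrderHom j) ≤ α.toOrderHom j := by
          intro j
          apply α.toOrderHom.monotone
          rw [Fin.le_def, he]
          split_ifs <;> lia
        refine ih _ ?_ (e ≫ α) ((congrArg α.toOrderHom he0).trans h0)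
          ((congrArg α.toOrderHom he1).trans h1) rfl
        rw [← hd]
        refine Finset.sum_lt_sum (fun j _ => hle j)
          ⟨⟨i₀ + 1, by lia⟩, Finset.mem_univ _, ?_⟩
        have hi : e.toOrderHom (⟨i₀ + 1, by lia⟩ : Fin (n + 3)) = i := Fin.ext (by
          rw [he, if_pos rfl])
        change (α.toOrderHom (e.toOrderHom (⟨i₀ + 1, by lia⟩ : Fin (n + 3)))).1 < _
        rw [hi, hk ⟨i₀ + 1, by lia⟩ (by rw [hi₀])]
        exact lt_of_le_of_ne (α.toOrderHom.monotone (Fin.le_last _)) fun h => hne (Fin.ext h)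

/-- The reduction is started at `α = 𝟙`. It ends at a constant face because `β` factors through the
edge `{0,1}` of `h`, which is the degenerate edge of `σ` at `a`. -/
theorem isCoCartesianTriangle_of_edge (hp : HasInnerLifts p) (hS : HasInnerLifts (toPoint S))
    {σ : X.toSSet _⦋2⦌} {hσ : IsLeftDegenerate σ} {a b : X.toSSet _⦋0⦌}
    {ha : triangleVertex σ 0 = a} {hb : triangleVertex σ 2 = b}
    (H : IsCoCartesianEdge (mappingSpaceMap p.toHom a b) (mappingSpaceEdge σ hσ ha hb)) :
    IsCoCartesianTriangle p.toHom σ := by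
  refine isCoCartesianTriangle_of_hornFills fun n h => ?_
  intro f y hfy hfh hfσ
  refine hp.hornFills_map (S := S) (n := n) hS h σ ?_ _ (𝟙 _) rfl rfl rfl f y hfy
    (by simpa using hfh) hfσ
  intro β hβ0 hβ1
  have hcone := coneMap_apply (firstEdge n) rfl rfl
  have hh : X.toSSet.map (firstEdge n).op h = constSimplex X.toSSet (op ⦋1⦌) a := by
    have hinl := vset_δ_mem_hornSet' (Fin.last (n + 3)) Fin.last_pos.ne'
    have h1 : f.val (firstEdge n ≫ SimplexCategory.δ (Fin.last (n + 3)))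
        (vset_δ_mem_hornSet _ Fin.last_pos.ne' _) = X.toSSet.map (firstEdge n).op h := by
      rw [← f.naturality _ _ hinl, hfh]
    rw [← h1, f.val_congr (coneInl_comp _).symm, ← f.naturality _ _
      (vset_coneMap _ (firstEdge_mem_hornSet n)),
      hfσ (coneMap (firstEdge n)) _ hcone.1 hcone.2.1 hcone.2.2]
    exact (mappingSpaceEdge σ hσ ha hb).2.1
  have hβh : X.toSSet.map β.op h = constSimplex X.toSSet (op ⦋n + 2⦌) a := by
    let c : ⦋n + 2⦌ ⟶ ⦋1⦌ := SimplexCategory.Hom.mk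
      ⟨fun j : Fin (n + 3) => (if j = 0 then 0 else 1 : Fin 2), by
        intro i j hij
        dsimp only
        split_ifs with hi hj hj
        · exact le_rfl
        · exact Fin.zero_le _
        · exact absurd (le_antisymm (hj ▸ hij) (Fin.zero_le _)) hi
        · exact le_rfl⟩
    have hc : c ≫ firstEdge n = β := by
      ext j : 3
      change (firstEdge n).toOrderHom (if (j : Fin (n + 3)) = 0 then 0 else 1 : Fin 2) = _
      by_cases hj : (j : Fin (n + 3)) = 0
      · rw [if_pos hj]
        exact hβ0.symm.trans (congrArg _ hj.symm)
      · rw [if_neg hj]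
        exact (hβ1 j (Fin.one_le_of_ne_zero hj)).symm
    rw [← hc, ← map_op_map_op, hh, map_constSimplex]
  rw [hβh]
  exact hornFills_const H n

end ScaledSSet

/-! ### From coCartesian triangles to coCartesian edges. -/

namespace SSet

variable {X S : SSet.{u}} {p : X ⟶ S} {σ : X _⦋2⦌} {hσ : IsLeftDegenerate σ} {a b : X _⦋0⦌}
  {ha : triangleVertex σ 0 = a} {hb : triangleVertex σ 2 = b}

theorem yonedaEquiv_ι_comp {M : ℕ} {Y : SSet.{u}} {i : Fin (M + 2)}
    (f : (Λ[M + 1, i] : SSet.{u}) ⟶ Y)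
    (j : Fin (M + 2)) (hj : j ≠ i) (hm : vset (SimplexCategory.δ j) ∈ hornSet i) :
    yonedaEquiv (horn.ι i j hj ≫ f) = (PartialMap.ofHorn f).val (SimplexCategory.δ j) hm := by
  rfl

/-- A horn in the mapping space, viewed as a horn in `X`. -/
theorem exists_horn_of_mappingSpace {n : ℕ}
    (f : PartialMap (n + 2) (hornSet 0) (mappingSpace X a b : SSet.{u})) :
    ∃ F : (Λ[n + 3, 0] : SSet.{u}) ⟶ X,
      (∀ hm, (PartialMap.ofHorn F).val (SimplexCategory.δ (Fin.last (n + 3))) hm =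
        constSimplex X (op ⦋n + 2⦌) a) ∧
      ∀ ⦃m : SimplexCategory⦄ (θ : m ⟶ ⦋n + 2⦌) (hθ : vset θ ∈ hornSet 0),
        (PartialMap.ofHorn F).val (coneMap θ) (vset_coneMap θ hθ) = (f.val θ hθ).1 := by
  have hδ : ∀ j : Fin (n + 3), j.castSucc ≠ 0 → vset (SimplexCategory.δ j) ∈ hornSet 0 :=
    fun j hj => vset_δ_mem_hornSet' j fun h => hj (by rw [h]; rfl)
  -- The faces of the horn in `X`: constant for the last index, and otherwise the simplex underlying
  -- the corresponding face in `X(a, b)`.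
  let x : ∀ j : Fin (n + 4), j ≠ 0 → X _⦋n + 2⦌ := fun j =>
    Fin.lastCases (motive := fun j => j ≠ 0 → X _⦋n + 2⦌)
      (fun _ => constSimplex X (op ⦋n + 2⦌) a)
      (fun j hj => (f.val (SimplexCategory.δ j) (hδ j hj)).1) j
  have hxl : ∀ h, x (Fin.last (n + 3)) h = constSimplex X (op ⦋n + 2⦌) a := by
    intro h
    exact congrFun (Fin.lastCases_last (motive := fun j => j ≠ 0 → X _⦋n + 2⦌)) h
  have hxc : ∀ j h, x (Fin.castSucc j) h = (f.val (SimplexCategory.δ j) (hδ j h)).1 := by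
    intro j h
    exact congrFun (Fin.lastCases_castSucc (motive := fun j => j ≠ 0 → X _⦋n + 2⦌) j) h
  have hcompat : horn.IsCompatible (n := n + 2) (i := 0) (fun j hj => yonedaEquiv.symm (x j hj)) := by
    rw [horn.isCompatible_iff]
    intro j k hj hk hjk
    rw [stdSimplex.δ_comp_yonedaEquiv_symm, stdSimplex.δ_comp_yonedaEquiv_symm]
    congr 1
    obtain ⟨j, rfl⟩ := j.eq_castSucc_of_ne_last (Fin.ne_last_of_lt hjk)
    have hj0 : j ≠ 0 := fun h => hj (by rw [h]; rfl)
    -- Compatibility with the last face is the constancy condition in the mapping space; between the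
    -- other faces it is naturality of the given horn.
    induction k using Fin.lastCases with
    | last =>
      rw [hxl, hxc]
      refine Eq.trans ?_ (map_constSimplex _ a).symm
      exact ((mem_mappingSpace_mk_iff _).1 (f.val (SimplexCategory.δ j) (hδ j hj)).2).1
    | cast k =>
      have hjk' : j < k := by simpa using hjk
      obtain ⟨k, rfl⟩ := k.eq_succ_of_ne_zero (Fin.ne_zero_of_lt hjk')
      obtain ⟨j, rfl⟩ := j.eq_castSucc_of_ne_last (Fin.ne_last_of_lt hjk')
      rw [hxc, hxc]
      have hc : SimplexCategory.δ k ≫ SimplexCategory.δ j.castSucc =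
          SimplexCategory.δ j ≫ SimplexCategory.δ k.succ :=
        (SimplexCategory.δ_comp_δ (by
          rw [Fin.castSucc_lt_succ_iff] at hjk'
          exact hjk')).symm
      have h1 := f.naturality (SimplexCategory.δ k) (SimplexCategory.δ j.castSucc) (hδ _ hj)
        (vset_δ_mem_hornSet _ hj0 _)
      have h2 := f.naturality (SimplexCategory.δ j) (SimplexCategory.δ k.succ) (hδ _ hk)
        (vset_δ_mem_hornSet _ (Fin.succ_ne_zero k) _)
      have h3 := congrArg Subtype.val (h1.trans ((f.val_congr hc _).trans h2.symm))
      have e1 : (Fin.castSucc k.succ).pred (Fin.ne_zero_of_lt hjk) = k.castSucc := by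
        ext; simp
      have e2 : (Fin.castSucc j.castSucc).castPred (Fin.ne_last_of_lt hjk) = j.castSucc := by
        ext; simp
      rw [e1, e2]
      change X.map (SimplexCategory.δ k.castSucc).op _ = X.map (SimplexCategory.δ j.castSucc).op _
      exact (congrArg (fun q : _ ⟶ ⦋n + 2⦌ => X.map q.op _) (coneMap_δ k).symm).trans
        (h3.trans (congrArg (fun q : _ ⟶ ⦋n + 2⦌ => X.map q.op _) (coneMap_δ j)))
  obtain ⟨F, hF⟩ := hcompat.exists_desc
  have hFx : ∀ j (hj : j ≠ 0) hm,
      (PartialMap.ofHorn F).val (SimplexCategory.δ j) hm = x j hj := by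
    intro j hj hm
    rw [← yonedaEquiv_ι_comp F j hj, hF, Equiv.apply_symm_apply]
  refine ⟨F, fun hm => (hFx _ Fin.last_pos.ne' hm).trans (hxl _), ?_⟩
  intro m θ hθ
  obtain ⟨j, hj, hjθ⟩ := id hθ
  obtain ⟨γ, rfl⟩ := exists_factor_δ j θ hjθ
  have hj' : j.castSucc ≠ 0 := fun h => hj (Fin.castSucc_injective _ h)
  have hc : coneMap (γ ≫ SimplexCategory.δ j) = coneHom γ ≫ SimplexCategory.δ j.castSucc := by
    rw [coneMap_comp, coneMap_δ]
  refine ((PartialMap.ofHorn F).val_congr hc _).trans ?_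
  refine ((PartialMap.ofHorn F).naturality (coneHom γ) (SimplexCategory.δ j.castSucc)
    (vset_δ_mem_hornSet' _ hj') _).symm.trans ?_
  refine (congrArg _ ((hFx _ hj' _).trans (hxc j hj'))).trans ?_
  exact congrArg Subtype.val (f.naturality γ (SimplexCategory.δ j) (hδ j hj') hθ)

theorem isCoCartesianEdge_of_triangle (H : IsCoCartesianTriangle p σ) :
    IsCoCartesianEdge (mappingSpaceMap p a b) (mappingSpaceEdge σ hσ ha hb) := by
  intro n f g comm hf
  obtain ⟨F, hF₁, hF₂⟩ := exists_horn_of_mappingSpace (PartialMap.ofHorn f)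
  obtain ⟨y, hyg⟩ : ∃ y : S _⦋n + 3⦌, y = (yonedaEquiv g).1 := ⟨_, rfl⟩
  have hy := (mem_mappingSpace_mk_iff _).1 (yonedaEquiv g).2
  rw [← hyg] at hy
  have hl0 : Fin.last (n + 3) ≠ 0 := Fin.last_pos.ne'
  have hcomm : F ≫ p = Λ[n + 3, 0].ι ≫ yonedaEquiv.symm y := by
    apply horn.hom_ext'
    intro j hj
    apply yonedaEquiv.injective
    have hm := vset_δ_mem_hornSet' j hj
    refine (congrArg (p.app _) (yonedaEquiv_ι_comp F j hj hm)).trans ?_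
    change _ = S.map (SimplexCategory.δ j).op y
    induction j using Fin.lastCases with
    | last => rw [hF₁, app_constSimplex, hy.1]
    | cast j =>
      have hj' : j ≠ 0 := fun h => hj (by rw [h]; rfl)
      have hm' := vset_δ_mem_hornSet' j hj'
      have h1 := hF₂ (SimplexCategory.δ j) hm'
      rw [(PartialMap.ofHorn F).val_congr (coneMap_δ j)] at h1
      refine (congrArg (p.app _) h1).trans ?_
      have h2 := congrArg (fun k : (Λ[n + 2, 0] : SSet.{u}) ⟶ (mappingSpace S _ _ : SSet.{u}) =>
        (k.app (op ⦋n + 1⦌) ⟨stdSimplex.objEquiv.symm (SimplexCategory.δ j),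
          (mem_horn_iff_vset _ _).2 hm'⟩).1) comm
      refine Eq.trans h2 ?_
      refine (congrArg Subtype.val
        (app_eq_map_yonedaEquiv g (stdSimplex.objEquiv.symm (SimplexCategory.δ j)))).trans ?_
      subst hyg
      exact congrArg (fun k : _ ⟶ ⦋n + 3⦌ => S.map k.op _) (coneMap_δ j)
  have htri : F.app (op ⦋2⦌) (hornTriangle n) = σ := by
    have h1 := hF₂ (firstEdge n) (firstEdge_mem_hornSet n)
    obtain ⟨c0, c1, c2⟩ := coneMap_apply (firstEdge n) rfl rfl
    refine Eq.trans (congrArg (F.app (op ⦋2⦌)) (Subtype.ext ?_)) (h1.trans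
      (congrArg Subtype.val hf))
    exact ((ScaledSSet.eq_triangle (stdSimplex.objEquiv.symm (coneMap (firstEdge n)))
      (Fin.zero_le _) (Fin.le_last _)).2 ⟨c0, c1, c2⟩).symm
  obtain ⟨l, hl₁, hl₂⟩ := H n F (yonedaEquiv.symm y) hcomm htri
  obtain ⟨z, hzl⟩ : ∃ z : X _⦋n + 3⦌, z = yonedaEquiv l := ⟨_, rfl⟩
  have hlF : ∀ ⦃m : SimplexCategory⦄ (θ : m ⟶ ⦋n + 3⦌) (hθ : vset θ ∈ hornSet 0),
      X.map θ.op z = (PartialMap.ofHorn F).val θ hθ := by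
    intro m θ hθ
    rw [hzl]
    refine (app_eq_map_yonedaEquiv l (stdSimplex.objEquiv.symm θ)).symm.trans ?_
    exact congrArg (fun k : (Λ[n + 3, 0] : SSet.{u}) ⟶ X => k.app (op m)
      ⟨stdSimplex.objEquiv.symm θ, (mem_horn_iff_vset _ _).2 hθ⟩) hl₁
  -- Both conditions concern simplices of the horn, so they are read off from `F`: the last face is
  -- constant, and the last vertex is the cone point over `firstEdge n`.
  have hlmem : z ∈ (mappingSpace X a b).obj (op ⦋n + 2⦌) := by
    refine (mem_mappingSpace_mk_iff _).2 ⟨?_, ?_⟩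
    · rw [hlF _ (vset_δ_mem_hornSet' _ hl0), hF₁]
    · have hm := vset_coneMap _ (firstEdge_mem_hornSet n)
      have h1 := hlF _ hm
      rw [hF₂ _ (firstEdge_mem_hornSet n)] at h1
      have h2 := ((mem_mappingSpace_mk_iff _).1
        ((PartialMap.ofHorn f).val (firstEdge n) (firstEdge_mem_hornSet n)).2).2
      rw [← h1, map_op_map_op] at h2
      refine Eq.trans ?_ h2
      exact congrArg (fun k : ⦋0⦌ ⟶ ⦋n + 3⦌ => X.map k.op z)
        (coneInr_comp (firstEdge n)).symm
  refine ⟨yonedaEquiv.symm ⟨z, hlmem⟩, ?_, ?_⟩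
  · ext m z
    apply Subtype.ext
    have hz := (mem_horn_iff_vset _ _).1 z.2
    exact (hlF (coneMap (stdSimplex.objEquiv z.1)) (vset_coneMap _ hz)).trans (hF₂ _ hz)
  · refine (yonedaEquiv_symm_comp _ _).trans ?_
    refine (Equiv.symm_apply_eq _).2 (Subtype.ext ?_)
    refine Eq.trans ?_ hyg
    have h1 : yonedaEquiv (l ≫ p) = y := (congrArg yonedaEquiv hl₂).trans
      (Equiv.apply_symm_apply _ _)
    exact (congrArg (p.app _) hzl).trans h1

end SSet

theorem mainTheorem8 {X S : ScaledSSet.{u}}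
    (hX : ScaledSSet.IsInfinityBicategory X) (hS : ScaledSSet.IsInfinityBicategory S)
    (p : X ⟶ S) (hp : ScaledSSet.IsWeakSFibration p)
    (a b : X.toSSet _⦋0⦌) (σ : X.toSSet _⦋2⦌) (hσ : SSet.IsLeftDegenerate σ)
    (ha : SSet.triangleVertex σ 0 = a) (hb : SSet.triangleVertex σ 2 = b) :
    SSet.IsCoCartesianTriangle p.toHom σ ↔
      SSet.IsCoCartesianEdge (SSet.mappingSpaceMap p.toHom a b)
        (SSet.mappingSpaceEdge σ hσ ha hb) :=
  ⟨SSet.isCoCartesianEdge_of_triangle,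
    ScaledSSet.isCoCartesianTriangle_of_edge hp.hasInnerLifts hS.hasInnerLifts⟩
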